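/- Let $d\ge 3$ be a prime, let $O_d$ be the ring of integers of $\mathbb{Q}(\sqrt{-d})\subset\mathbb{C}$, and let $\sigma\in PSL_2(O_d)$ be the class of the matrix $\begin{pmatrix}1&\xi\\0&1\end{pmatrix}$, where $\xi\in O_d$ and $d\nmid|\xi|^2$. For a positive integer $D$ let $\mathcal{C}_D=\{z\in\mathbb{C}:|z|=\sqrt{D}\}$, and let $\mathrm{Stab}(\mathcal{C}_D)$ be the group of all $g\in PSL_2(O_d)$ whose action on $\widehat{\mathbb{C}}=\mathbb{C}\cup\{\infty\}$ by linear fractional transformations maps $\mathcal{C}_D$ to itself and preserves each of the two components of $\widehat{\mathbb{C}}\setminus\mathcal{C}_D$. Then there is a sequence of distinct positive integers $D_k$ $(k=0,1,2,\dots)$, each a quadratic non-residue modulo $d$, such that: 1. each $\mathrm{Stab}(\mathcal{C}_{D_k})$ is a co-compact Fuchsian group, that is, a discrete subgroup of $PSL_2(\mathbb{C})$ that stabilizes a circle in $\widehat{\mathbb{C}}$, preserves the components of its complement, and acts with compact quotient on the hyperbolic plane in $\mathbb{H}^3$ bounded by that circle; 2. for every $k$, the normal closure of $\sigma$ in $PSL_2(O_d)$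 intersects $\mathrm{Stab}(\mathcal{C}_{D_k})$ in a nontrivial group; 3. for $j\ne k$, the groups $\mathrm{Stab}(\mathcal{C}_{D_j})$ and $\mathrm{Stab}(\mathcal{C}_{D_k})$ are not commensurable in $PSL_2(O_d)$, that is, there is no $g\in PSL_2(O_d)$ for which $g\,\mathrm{Stab}(\mathcal{C}_{D_j})\,g^{-1}\cap\mathrm{Stab}(\mathcal{C}_{D_k})$ has finite index in both $g\,\mathrm{Stab}(\mathcal{C}_{D_j})\,g^{-1}$ and $\mathrm{Stab}(\mathcal{C}_{D_k})$. -/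

import Mathlib

open scoped NumberField Pointwise MatrixGroups UpperHalfPlane

noncomputable section

namespace Bianchi

/-- The imaginary quadratic field `ℚ(√-d)`, as a subfield of `ℂ`. -/
abbrev imQuadField (d : ℕ) : IntermediateField ℚ ℂ :=
  IntermediateField.adjoin ℚ {Complex.I * (Real.sqrt d : ℂ)}

/-- The ring of integers `O_d` of `ℚ(√-d)`. -/
abbrev ringOfInt (d : ℕ) : Type := 𝓞 (imQuadField d)

/-- `PSL₂(R)`. -/
abbrev PSL2 (R : Type*) [CommRing R] : Type _ :=
  Matrix.ProjectiveSpecialLinearGroup (Fin 2) R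

/-- The quotient map `P : SL₂(R) → PSL₂(R)`. -/
def P (R : Type*) [CommRing R] : SL(2, R) →* PSL2 R :=
  QuotientGroup.mk' (Subgroup.center SL(2, R))

/-- The homomorphism `PSL₂(R) → PSL₂(S)` induced by a ring homomorphism `R → S`. -/
def PSL2map {R S : Type*} [CommRing R] [CommRing S] (f : R →+* S) : PSL2 R →* PSL2 S :=
  QuotientGroup.map (Subgroup.center SL(2, R)) (Subgroup.center SL(2, S))
    (Matrix.SpecialLinearGroup.map f) (by
      intro A hA
      rw [Matrix.SpecialLinearGroup.mem_center_iff] at hA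
      obtain ⟨r, hr, hA⟩ := hA
      rw [Subgroup.mem_comap, Matrix.SpecialLinearGroup.mem_center_iff]
      refine ⟨f r, by rw [← map_pow, hr, map_one], ?_⟩
      ext i j
      have h := congrArg f (congrFun (congrFun hA i) j)
      by_cases hij : i = j
      · subst hij
        simpa [Matrix.scalar_apply] using h
      · simpa [Matrix.scalar_apply, hij] using h)

/-- The inclusion of the Bianchi group `PSL₂(O_d)` into `PSL₂(ℂ)`. -/
def incl (d : ℕ) : PSL2 (ringOfInt d) →* PSL2 ℂ :=
  PSL2map (algebraMap (ringOfInt d) ℂ)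

/-- The unipotent matrix with rows `(1, ξ)` and `(0, 1)`. -/
def unipotent {R : Type*} [CommRing R] (ξ : R) : SL(2, R) :=
  ⟨!![1, ξ; 0, 1], by simp [Matrix.det_fin_two]⟩

/-- `PSL₂(ℂ)` acts on the Riemann sphere by linear fractional transformations (through the
identification of the sphere with the complex projective line). -/
instance : MulAction (PSL2 ℂ) (OnePoint ℂ) :=
  (OnePoint.equivProjectivization ℂ).mulAction (PSL2 ℂ)

/-- The circles of the Riemann sphere: Euclidean circles in `ℂ`, and lines together with `∞`. -/
def IsCircle (C : Set (OnePoint ℂ)) : Prop :=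
  (∃ (z : ℂ) (r : ℝ), 0 < r ∧ C = (fun w : ℂ => (w : OnePoint ℂ)) '' Metric.sphere z r) ∨
  (∃ p v : ℂ, v ≠ 0 ∧
    C = insert OnePoint.infty (Set.range fun t : ℝ => ((p + t * v : ℂ) : OnePoint ℂ)))

/-- The extended real line. -/
def realCircle : Set (OnePoint ℂ) :=
  insert OnePoint.infty (Set.range fun t : ℝ => ((t : ℂ) : OnePoint ℂ))

/-- The stabilizer in `PSL₂(ℂ)` of a circle `C`: the elements that map `C` to itself and that map
every connected component of the complement of `C` to itself. -/
def circleStab (C : Set (OnePoint ℂ)) : Subgroup (PSL2 ℂ) :=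
  MulAction.stabilizer (PSL2 ℂ) C ⊓
    ⨅ x ∈ Cᶜ, MulAction.stabilizer (PSL2 ℂ) (connectedComponentIn Cᶜ x)

/-- The subgroup of all `s ∈ SL₂(ℝ)` such that `g⁻¹ P(s) g ∈ Γ`. If `Γ` stabilizes `C`
and `g` maps `C` to the extended real line, its image in `PSL₂(ℂ)` is `g Γ g⁻¹`. -/
def realModel (Γ : Subgroup (PSL2 ℂ)) (g : PSL2 ℂ) : Subgroup SL(2, ℝ) :=
  Γ.comap ((MulAut.conj g⁻¹).toMonoidHom.comp
    ((P ℂ).comp (Matrix.SpecialLinearGroup.map Complex.ofRealHom)))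

/-- Co-compact Fuchsian groups: discrete subgroups `Γ` of the stabilizer in `PSL₂(ℂ)` of some
circle `C` for which the hyperbolic plane bounded by `C` has compact quotient by `Γ`. That plane
with its `Γ`-action is transported to the upper half-plane with its action of `g Γ g⁻¹`, by
some `g` that maps `C` to the extended real line. -/
def IsCocompactFuchsian (Γ : Subgroup (PSL2 ℂ)) : Prop :=
  DiscreteTopology Γ ∧
  ∃ C : Set (OnePoint ℂ), IsCircle C ∧ Γ ≤ circleStab C ∧
    ∃ g : PSL2 ℂ, g • C = realCircle ∧
      CompactSpace (Quotient (MulAction.orbitRel (realModel Γ g) ℍ))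

/-- `H` and `K` are commensurable in the ambient group `G`: for some `g`, the intersection of
`g H g⁻¹` and `K` has finite index in both. -/
def CommensurableIn {G : Type*} [Group G] (H K : Subgroup G) : Prop :=
  ∃ g : G, Subgroup.Commensurable (H.map (MulAut.conj g).toMonoidHom) K

/-- The circle `C_D` with centre `0` and radius `√D`. -/
def circleOf (D : ℕ) : Set (OnePoint ℂ) :=
  (fun w : ℂ => (w : OnePoint ℂ)) '' Metric.sphere 0 (Real.sqrt D)

/-- `Stab(C)` in the Bianchi group `PSL₂(O_d)`. -/
def bianchiStab (d : ℕ) (C : Set (OnePoint ℂ)) : Subgroup (PSL2 (ringOfInt d)) :=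
  (circleStab C).comap (incl d)

end Bianchi

end

/-!
Write `N = |ξ|²`, an integer prime to `d`, and let `Stab(C_D)` be described by the matrices with
rows `(a, D c̄)` and `(c, ā)`, which preserve the Hermitian form `|z|² - D |w|²`
(`P_mem_circleStab`, `form_of_mem_circleStab`).

*Normal closure.* For `γ` with first column `(x, ξ̄)`, the element `σ^(2c) γ σ² γ⁻¹` of the normal
closure has lower left entry `-2 ξ ξ̄² ≠ 0`, and it has the shape above as soon as
`x + x̄ = -2 c N` and `|x|² = c + D N`. Take `x = -c N + s √-d` with `s ≡ 1` modulo `N`. As `N` is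
prime to `d`, the column is unimodular, and it remains to solve `c² N² + d s² = c + D N`. The choice
`c = d + N v` leaves one free parameter in `s` and gives `D ≡ v (N³ v - 1)` modulo `d`; since `N`
is a square modulo `d`, some `v` makes this a non-residue (`exists_radii`,
`normalClosure_inf_bianchiStab_ne_bot`).

*Cocompactness.* If `D` is a non-residue, the reduced norm `|a|² - D |c|²` has no nontrivial zero on
`ℤ[√-d]²`, by descent at `d` (`nrd_ne_zero`). Given a unimodular frame, Dirichlet's approximation
theorem yields a nonzero vector of `ℤ[√-d]²` that is short in it (`exists_short_vector`), so its
reduced norm `n` is one of finitely many nonzero integers. Two vectors of reduced norm `n` that are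
congruent modulo `n` differ by a unit of reduced norm one; hence a unit moves the frame into a fixed
bounded set (`exists_bounded_representative`). A Cayley transform carries this to the upper
half-plane (`compactSpace_quotient`).

*Non-commensurability.* Pell's equation for `D` and for `d D` provides two elements `p + c X` of
`Stab(C_D)`, all of whose powers are again of this form with `c ≠ 0`. If `G Stab(C_D') G⁻¹` meets
`Stab(C_D)` in finite index, it contains powers of both, so both matrices `X` are skew for the form
of the circle `G C_D'`. This leaves only the multiples of the form of `C_D`, and integrality forces
`D' = D` (`not_commensurableIn`).
-/

noncomputable section

namespace Bianchi

open ComplexConjugate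

/-! ### Möbius transformations and the two sides of `C_D` -/

lemma P_smul_eq (A : SL(2, ℂ)) (p : OnePoint ℂ) :
    P ℂ A • p = (A : GL (Fin 2) ℂ) • p := by
  apply (OnePoint.equivProjectivization ℂ).injective
  rw [OnePoint.equivProjectivization_smul, Equiv.smul_def, Equiv.apply_symm_apply]
  generalize OnePoint.equivProjectivization ℂ p = q
  induction q using Projectivization.ind with
  | h v hv => rfl

lemma P_smul_coe (A : SL(2, ℂ)) (z : ℂ) : P ℂ A • (z : OnePoint ℂ) =
    if A 1 0 * z + A 1 1 = 0 then OnePoint.infty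
    else (((A 0 0 * z + A 0 1) / (A 1 0 * z + A 1 1) : ℂ) : OnePoint ℂ) := by
  rw [P_smul_eq, OnePoint.smul_some_eq_ite]
  norm_cast

lemma P_smul_infty (A : SL(2, ℂ)) : P ℂ A • (OnePoint.infty : OnePoint ℂ) =
    if A 1 0 = 0 then OnePoint.infty else ((A 0 0 / A 1 0 : ℂ) : OnePoint ℂ) := by
  rw [P_smul_eq, OnePoint.smul_infty_eq_ite]
  norm_cast

lemma isPreconnected_norm_gt (r : ℝ) : IsPreconnected {z : ℂ | r < ‖z‖} := by
  rcases lt_or_ge r 0 with hr | hr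
  · rw [show {z : ℂ | r < ‖z‖} = Set.univ from
      Set.eq_univ_of_forall fun z => hr.trans_le (norm_nonneg z)]
    exact isPreconnected_univ
  have h : {z : ℂ | r < ‖z‖} =
      (fun q : ℝ × ℝ => (q.1 : ℂ) * Complex.exp (q.2 * Complex.I)) '' (Set.Ioi r ×ˢ Set.univ) := by
    ext z
    constructor
    · intro hz
      exact ⟨(‖z‖, z.arg), ⟨hz, trivial⟩, Complex.norm_mul_exp_arg_mul_I z⟩
    · rintro ⟨⟨s, θ⟩, ⟨hs, -⟩, rfl⟩
      have hs' : r < s := hs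
      simpa [Complex.norm_exp, abs_of_pos (hr.trans_lt hs')] using hs'
  rw [h]
  exact (isPreconnected_Ioi.prod isPreconnected_univ).image _ (by fun_prop)

lemma isPreconnected_insert_infty (r : ℝ) : IsPreconnected
    (insert OnePoint.infty ((fun w : ℂ => (w : OnePoint ℂ)) '' {z : ℂ | r < ‖z‖})) := by
  refine ((isPreconnected_norm_gt r).image _ OnePoint.continuous_coe.continuousOn).subset_closure
    (Set.subset_insert _ _) (Set.insert_subset ?_ subset_closure)
  rw [mem_closure_iff]
  intro o ho hmem
  rw [OnePoint.isOpen_iff_of_mem hmem] at ho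
  obtain ⟨R, hR⟩ := ho.2.isBounded.subset_closedBall (0 : ℂ)
  set s : ℝ := max |R| |r| + 1
  have h1 : |R| < s := lt_of_le_of_lt (le_max_left _ _) (lt_add_one _)
  have h2 : |r| < s := lt_of_le_of_lt (le_max_right _ _) (lt_add_one _)
  have hs : 0 < s := (abs_nonneg _).trans_lt h1
  refine ⟨((s : ℂ) : OnePoint ℂ), ?_, (s : ℂ), ?_, rfl⟩
  · by_contra hc
    have := hR (show (s : ℂ) ∈ ((↑) ⁻¹' o : Set ℂ)ᶜ from hc)
    simp [abs_of_pos hs] at this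
    linarith [le_abs_self R]
  · simpa [abs_of_pos hs] using (le_abs_self r).trans_lt h2

/-- A function on the Riemann sphere that is zero on `C_D`, negative inside and positive
outside: `|z|² - D` at finite points, and `1` at `∞`. -/
def sideFun (D : ℕ) (p : OnePoint ℂ) : ℝ :=
  p.elim 1 fun z => Complex.normSq z - D

@[simp] lemma sideFun_infty (D : ℕ) : sideFun D OnePoint.infty = 1 := rfl
@[simp] lemma sideFun_coe (D : ℕ) (z : ℂ) :
    sideFun D (z : OnePoint ℂ) = Complex.normSq z - D := rfl

lemma mem_circleOf_iff {D : ℕ} {p : OnePoint ℂ} : p ∈ circleOf D ↔ sideFun D p = 0 := by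
  induction p using OnePoint.rec with
  | infty => simp [circleOf]
  | coe z =>
    rw [sideFun_coe, sub_eq_zero, Complex.normSq_eq_norm_sq, ← Real.sq_sqrt (Nat.cast_nonneg D),
      pow_left_inj₀ (norm_nonneg _) (Real.sqrt_nonneg _) two_ne_zero]
    simp [circleOf]

lemma interiorSide_eq (D : ℕ) : {p : OnePoint ℂ | sideFun D p < 0} =
    (fun w : ℂ => (w : OnePoint ℂ)) '' Metric.ball 0 (Real.sqrt D) := by
  ext p
  induction p using OnePoint.rec with
  | infty => simp
  | coe z =>
    simp only [Set.mem_ofPred_eq, sideFun_coe, sub_neg, Complex.normSq_eq_norm_sq]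
    rw [← Real.lt_sqrt (norm_nonneg _)]
    simp

lemma exteriorSide_eq (D : ℕ) : {p : OnePoint ℂ | 0 < sideFun D p} =
    insert OnePoint.infty
      ((fun w : ℂ => (w : OnePoint ℂ)) '' {z : ℂ | Real.sqrt D < ‖z‖}) := by
  ext p
  induction p using OnePoint.rec with
  | infty => simp
  | coe z =>
    simp only [Set.mem_ofPred_eq, sideFun_coe, sub_pos, Complex.normSq_eq_norm_sq]
    rw [← Real.sqrt_lt (Nat.cast_nonneg D) (norm_nonneg _)]
    simp

lemma isOpen_interiorSide (D : ℕ) : IsOpen {p : OnePoint ℂ | sideFun D p < 0} := by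
  rw [interiorSide_eq]
  exact OnePoint.isOpenEmbedding_coe.isOpenMap _ Metric.isOpen_ball

lemma isOpen_exteriorSide (D : ℕ) : IsOpen {p : OnePoint ℂ | 0 < sideFun D p} := by
  have : {p : OnePoint ℂ | 0 < sideFun D p} =
      ((fun w : ℂ => (w : OnePoint ℂ)) '' Metric.closedBall 0 (Real.sqrt D))ᶜ := by
    rw [exteriorSide_eq]
    ext p
    induction p using OnePoint.rec <;> simp
  rw [this]
  exact OnePoint.isOpen_compl_image_coe.2
    ⟨Metric.isClosed_closedBall, isCompact_closedBall _ _⟩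

lemma isPreconnected_exteriorSide (D : ℕ) :
    IsPreconnected {p : OnePoint ℂ | 0 < sideFun D p} := by
  rw [exteriorSide_eq]; exact isPreconnected_insert_infty _

lemma isPreconnected_interiorSide (D : ℕ) :
    IsPreconnected {p : OnePoint ℂ | sideFun D p < 0} := by
  rw [interiorSide_eq]
  exact (convex_ball _ _).isPreconnected.image _ OnePoint.continuous_coe.continuousOn

lemma component_exterior {D : ℕ} {x : OnePoint ℂ} (hx : 0 < sideFun D x) :
    connectedComponentIn (circleOf D)ᶜ x = {p | 0 < sideFun D p} := by
  have hxC : x ∈ (circleOf D)ᶜ := fun h => hx.ne' (mem_circleOf_iff.1 h)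
  refine subset_antisymm ?_ ((isPreconnected_exteriorSide D).subset_connectedComponentIn hx
    fun p hp h => (ne_of_gt hp) (mem_circleOf_iff.1 h))
  refine isPreconnected_connectedComponentIn.subset_left_of_subset_union (isOpen_exteriorSide D)
    (isOpen_interiorSide D) ?_ ?_ ⟨x, mem_connectedComponentIn hxC, hx⟩
  · exact Set.disjoint_left.2 fun p h1 h2 => lt_asymm (α := ℝ) h1 h2
  · intro p hp
    have := connectedComponentIn_subset _ _ hp
    exact (lt_or_gt_of_ne fun h => this (mem_circleOf_iff.2 h)).symm

lemma component_interior {D : ℕ} {x : OnePoint ℂ} (hx : sideFun D x < 0) :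
    connectedComponentIn (circleOf D)ᶜ x = {p | sideFun D p < 0} := by
  have hxC : x ∈ (circleOf D)ᶜ := fun h => hx.ne (mem_circleOf_iff.1 h)
  refine subset_antisymm ?_ ((isPreconnected_interiorSide D).subset_connectedComponentIn hx
    fun p hp h => (ne_of_lt hp) (mem_circleOf_iff.1 h))
  refine isPreconnected_connectedComponentIn.subset_left_of_subset_union (isOpen_interiorSide D)
    (isOpen_exteriorSide D) ?_ ?_ ⟨x, mem_connectedComponentIn hxC, hx⟩
  · exact Set.disjoint_left.2 fun p h1 h2 => lt_asymm (α := ℝ) h1 h2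
  · intro p hp
    have := connectedComponentIn_subset _ _ hp
    exact (lt_or_gt_of_ne fun h => this (mem_circleOf_iff.2 h))

/-- By the description of the components as the level sets of the sign of `sideFun`, an element
that does not change this sign stabilizes `C_D` and both components. -/
lemma mem_circleStab_of_sideFun {D : ℕ} {g : PSL2 ℂ}
    (h : ∀ p, ∃ t : ℝ, 0 < t ∧ sideFun D (g • p) = t * sideFun D p) :
    g ∈ circleStab (circleOf D) := by
  have hsign : ∀ p, SignType.sign (sideFun D (g • p)) = SignType.sign (sideFun D p) := by
    intro p
    obtain ⟨t, ht, h⟩ := h p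
    rw [h, sign_mul, sign_pos ht, one_mul]
  have key : ∀ S : Set (OnePoint ℂ), (∀ p, g • p ∈ S ↔ p ∈ S) →
      g ∈ MulAction.stabilizer (PSL2 ℂ) S := by
    intro S hS
    rw [MulAction.mem_stabilizer_iff]
    ext p
    rw [Set.mem_smul_set_iff_inv_smul_mem, ← hS (g⁻¹ • p), smul_inv_smul]
  refine Subgroup.mem_inf.2 ⟨key _ fun p => ?_, ?_⟩
  · rw [mem_circleOf_iff, mem_circleOf_iff, ← sign_eq_zero_iff, hsign, sign_eq_zero_iff]
  · simp only [Subgroup.mem_iInf]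
    intro x hx
    apply key
    intro p
    rcases lt_trichotomy (sideFun D x) 0 with h0 | h0 | h0
    · rw [component_interior h0]
      simp only [Set.mem_ofPred_eq]
      rw [← sign_eq_neg_one_iff, hsign, sign_eq_neg_one_iff]
    · exact absurd (mem_circleOf_iff.2 h0) hx
    · rw [component_exterior h0]
      simp only [Set.mem_ofPred_eq]
      rw [← sign_eq_one_iff, hsign, sign_eq_one_iff]

/-- An element of `SL₂(ℂ)` that preserves the Hermitian form `|z|² - D|w|²`
preserves the circle `C_D` and its sides. -/
lemma P_mem_circleStab {D : ℕ} (A : SL(2, ℂ)) (h0 : A 1 1 = conj (A 0 0))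
    (h1 : A 0 1 = D * conj (A 1 0)) : P ℂ A ∈ circleStab (circleOf D) := by
  have hdet := A.det_coe
  rw [Matrix.det_fin_two, h0, h1] at hdet
  have hdet' : Complex.normSq (A 0 0) - D * Complex.normSq (A 1 0) = 1 := by
    have := congrArg Complex.re hdet
    simp [Complex.normSq_apply] at this ⊢
    linarith
  have key : ∀ z : ℂ, Complex.normSq (A 0 0 * z + A 0 1) - D * Complex.normSq (A 1 0 * z + A 1 1)
      = Complex.normSq z - D := by
    intro z
    rw [h0, h1]
    simp only [Complex.normSq_apply] at hdet' ⊢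
    simp
    linear_combination (z.re * z.re + z.im * z.im - D) * hdet'
  apply mem_circleStab_of_sideFun
  intro p
  induction p using OnePoint.rec with
  | infty =>
    rw [P_smul_infty]
    split_ifs with hc
    · exact ⟨1, one_pos, by simp⟩
    · have hpos : 0 < Complex.normSq (A 1 0) := Complex.normSq_pos.2 hc
      refine ⟨(Complex.normSq (A 1 0))⁻¹, inv_pos.2 hpos, ?_⟩
      rw [sideFun_coe, sideFun_infty, map_div₀]
      field_simp
      linarith
  | coe z =>
    rw [P_smul_coe]
    have := key z
    split_ifs with hc
    · rw [hc] at this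
      simp only [map_zero, mul_zero, sub_zero] at this
      have hpos : 0 < Complex.normSq (A 0 0 * z + A 0 1) := by
        rw [Complex.normSq_pos]
        intro hz
        have hd := A.det_coe
        rw [Matrix.det_fin_two] at hd
        have h3 : (A 0 0 * A 1 1 - A 0 1 * A 1 0) = A 0 0 * (A 1 0 * z + A 1 1) -
          A 1 0 * (A 0 0 * z + A 0 1) := by ring
        rw [h3, hc, hz] at hd
        simp at hd
      refine ⟨(Complex.normSq (A 0 0 * z + A 0 1))⁻¹, inv_pos.2 hpos, ?_⟩
      rw [sideFun_coe, ← this, sideFun_infty, inv_mul_cancel₀ hpos.ne']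
    · have hpos := Complex.normSq_pos.2 hc
      refine ⟨(Complex.normSq (A 1 0 * z + A 1 1))⁻¹, inv_pos.2 hpos, ?_⟩
      rw [sideFun_coe, sideFun_coe, ← this, map_div₀, sub_eq_iff_eq_add, div_eq_iff hpos.ne']
      rw [add_mul, mul_right_comm, inv_mul_cancel₀ hpos.ne']
      ring

/-- Conversely an element of `SL₂(ℂ)` that maps `C_D` to itself multiplies the form by a
scalar; the two equations are the entries of that proportionality. -/
lemma form_of_mem_circleStab {D : ℕ} (hD : 0 < D) (A : SL(2, ℂ))
    (h : P ℂ A ∈ circleStab (circleOf D)) :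
    A 0 0 * conj (A 0 1) = D * (A 1 0 * conj (A 1 1)) ∧
    (Complex.normSq (A 0 1) - D * Complex.normSq (A 1 1) =
      - D * (Complex.normSq (A 0 0) - D * Complex.normSq (A 1 0))) := by
  have hst := (Subgroup.mem_inf.1 h).1
  rw [MulAction.mem_stabilizer_iff] at hst
  have key : ∀ z : ℂ, Complex.normSq z = D →
      Complex.normSq (A 0 0 * z + A 0 1) - D * Complex.normSq (A 1 0 * z + A 1 1) = 0 := by
    intro z hz
    have hmem : P ℂ A • (z : OnePoint ℂ) ∈ circleOf D := by
      rw [← hst]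
      exact Set.smul_mem_smul_set (mem_circleOf_iff.2 (by simp [hz]))
    rw [mem_circleOf_iff, P_smul_coe] at hmem
    split_ifs at hmem with hc
    · simp at hmem
    · rw [sideFun_coe, map_div₀, sub_eq_zero,
        div_eq_iff (Complex.normSq_pos.2 hc).ne'] at hmem
      linarith
  have hs : Real.sqrt D * Real.sqrt D = D := Real.mul_self_sqrt (Nat.cast_nonneg D)
  have hs0 : 0 < Real.sqrt D := Real.sqrt_pos.2 (by exact_mod_cast hD)
  have k1 := key (Real.sqrt D) (by simp [Complex.normSq_apply])
  have k2 := key (-Real.sqrt D) (by simp [Complex.normSq_apply])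
  have k3 := key (Complex.I * Real.sqrt D) (by simp [Complex.normSq_apply])
  simp [Complex.normSq_apply] at k1 k2 k3 ⊢
  have e1 : (A 0 0).re * (A 0 1).re + (A 0 0).im * (A 0 1).im =
      D * ((A 1 0).re * (A 1 1).re + (A 1 0).im * (A 1 1).im) := by
    apply mul_left_cancel₀ hs0.ne'
    linarith
  have e2 : (A 0 1).re * (A 0 1).re + (A 0 1).im * (A 0 1).im -
      D * ((A 1 1).re * (A 1 1).re + (A 1 1).im * (A 1 1).im) =
      -(D * ((A 0 0).re * (A 0 0).re + (A 0 0).im * (A 0 0).im -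
        D * ((A 1 0).re * (A 1 0).re + (A 1 0).im * (A 1 0).im))) := by
    linear_combination (k1 + k2) / 2 - ((A 0 0).re * (A 0 0).re + (A 0 0).im * (A 0 0).im -
        D * ((A 1 0).re * (A 1 0).re + (A 1 0).im * (A 1 0).im)) * hs
  have e3 : -(A 0 0).im * (A 0 1).re + (A 0 0).re * (A 0 1).im =
      D * (-(A 1 0).im * (A 1 1).re + (A 1 0).re * (A 1 1).im) := by
    apply mul_left_cancel₀ hs0.ne'
    linear_combination k3 / 2 - e2 / 2 - ((A 0 0).re * (A 0 0).re + (A 0 0).im * (A 0 0).im -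
        D * ((A 1 0).re * (A 1 0).re + (A 1 0).im * (A 1 0).im)) * hs / 2
  refine ⟨?_, e2⟩
  apply Complex.ext
  · simp; linarith
  · simp; linarith

/-! ### Integers of `ℚ(√-d)` and the choice of the radii -/

lemma I_sqrt_sq (d : ℕ) : (Complex.I * (Real.sqrt d : ℂ)) ^ 2 = -(d : ℂ) := by
  rw [mul_pow, Complex.I_sq, ← Complex.ofReal_pow, Real.sq_sqrt (Nat.cast_nonneg d)]
  simp

lemma exists_rat_of_mem (d : ℕ) {z : ℂ} (hz : z ∈ imQuadField d) :
    ∃ p q : ℚ, z = p + q * (Complex.I * (Real.sqrt d : ℂ)) := by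
  have hsq := I_sqrt_sq d
  induction hz using IntermediateField.adjoin_induction with
  | mem x hx =>
    rw [Set.mem_singleton_iff] at hx
    exact ⟨0, 1, by simp [hx]⟩
  | algebraMap x => exact ⟨x, 0, by simp⟩
  | add x y _ _ hx hy =>
    obtain ⟨p, q, rfl⟩ := hx
    obtain ⟨r, s, rfl⟩ := hy
    exact ⟨p + r, q + s, by push_cast; ring⟩
  | inv x _ hx =>
    obtain ⟨p, q, rfl⟩ := hx
    rcases eq_or_ne ((p : ℂ) + q * (Complex.I * (Real.sqrt d : ℂ))) 0 with h | h
    · exact ⟨0, 0, by simp [h]⟩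
    · refine ⟨p / (p ^ 2 + d * q ^ 2), -q / (p ^ 2 + d * q ^ 2), ?_⟩
      have hn : (p : ℂ) ^ 2 + d * q ^ 2 ≠ 0 := by
        intro h0
        have h1 : p ^ 2 + d * q ^ 2 = 0 := by exact_mod_cast h0
        have hp : p = 0 := by
          have : 0 ≤ (d : ℚ) * q ^ 2 := by positivity
          have : p ^ 2 = 0 := by nlinarith [sq_nonneg p]
          simpa using this
        rw [hp] at h1
        simp only [ne_eq, OfNat.ofNat_ne_zero, not_false_eq_true, zero_pow, zero_add,
          mul_eq_zero, pow_eq_zero_iff] at h1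
        rcases h1 with h1 | h1
        · apply h
          simp [hp, show d = 0 by exact_mod_cast h1]
        · apply h
          simp [hp, h1]
      apply inv_eq_of_mul_eq_one_right
      push_cast
      have h1 : ((p : ℂ) + q * (Complex.I * (Real.sqrt d : ℂ))) * (p / (p ^ 2 + d * q ^ 2) +
          -q / (p ^ 2 + d * q ^ 2) * (Complex.I * (Real.sqrt d : ℂ))) =
          (p ^ 2 - q ^ 2 * (Complex.I * (Real.sqrt d : ℂ)) ^ 2) / (p ^ 2 + d * q ^ 2) := by ring
      rw [h1, hsq, div_eq_one_iff_eq hn]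
      ring
  | mul x y _ _ hx hy =>
    obtain ⟨p, q, rfl⟩ := hx
    obtain ⟨r, s, rfl⟩ := hy
    exact ⟨p * r - d * q * s, p * s + q * r, by push_cast; linear_combination (q * s : ℂ) * hsq⟩

/-- The square root of `-d` in `O_d`. -/
def sqrtNeg (d : ℕ) : ringOfInt d :=
  ⟨⟨Complex.I * (Real.sqrt d : ℂ), IntermediateField.mem_adjoin_simple_self ℚ _⟩, by
    refine ⟨Polynomial.X ^ 2 + Polynomial.C (d : ℤ),
      Polynomial.monic_X_pow_add_C _ two_ne_zero, ?_⟩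
    apply Subtype.ext
    simp [I_sqrt_sq]⟩

lemma coe_sqrtNeg (d : ℕ) : algebraMap (ringOfInt d) ℂ (sqrtNeg d) =
    Complex.I * (Real.sqrt d : ℂ) := rfl

lemma algebraMap_injective (d : ℕ) : Function.Injective (algebraMap (ringOfInt d) ℂ) :=
  FaithfulSMul.algebraMap_injective _ _

lemma sqrtNeg_sq (d : ℕ) : sqrtNeg d ^ 2 = -(d : ringOfInt d) := by
  apply algebraMap_injective d
  rw [map_pow, coe_sqrtNeg, I_sqrt_sq]
  simp

lemma coe_mem (d : ℕ) (x : ringOfInt d) : algebraMap (ringOfInt d) ℂ x ∈ imQuadField d :=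
  (x : imQuadField d).2

lemma coe_isIntegral (d : ℕ) (x : ringOfInt d) : IsIntegral ℤ (algebraMap (ringOfInt d) ℂ x) :=
  (NumberField.RingOfIntegers.isIntegral x).algebraMap

lemma conj_coe_mem (d : ℕ) (x : ringOfInt d) :
    conj (algebraMap (ringOfInt d) ℂ x) ∈ imQuadField d := by
  obtain ⟨p, q, h⟩ := exists_rat_of_mem d (coe_mem d x)
  have : conj (algebraMap (ringOfInt d) ℂ x) =
      algebraMap ℚ ℂ p - algebraMap ℚ ℂ q * (Complex.I * (Real.sqrt d : ℂ)) := by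
    rw [h]; simp [sub_eq_add_neg]
  rw [this]
  exact sub_mem (IntermediateField.algebraMap_mem _ p) (mul_mem
    (IntermediateField.algebraMap_mem _ q) (IntermediateField.mem_adjoin_simple_self ℚ _))

lemma conj_coe_isIntegral (d : ℕ) (x : ringOfInt d) :
    IsIntegral ℤ (conj (algebraMap (ringOfInt d) ℂ x)) :=
  (coe_isIntegral d x).map (starRingEnd ℂ).toIntAlgHom

/-- Complex conjugation on `O_d`. -/
def conjInt (d : ℕ) (x : ringOfInt d) : ringOfInt d :=
  ⟨⟨conj (algebraMap (ringOfInt d) ℂ x), conj_coe_mem d x⟩,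
    (isIntegral_algebraMap_iff (B := ℂ) (algebraMap (imQuadField d) ℂ).injective).1
      (conj_coe_isIntegral d x)⟩

lemma coe_conjInt (d : ℕ) (x : ringOfInt d) : algebraMap (ringOfInt d) ℂ (conjInt d x) =
    conj (algebraMap (ringOfInt d) ℂ x) := rfl

lemma exists_int_of_rat {z : ℂ} (hz : IsIntegral ℤ z) {p : ℚ} (h : z = p) :
    ∃ m : ℤ, z = m := by
  have h1 : IsIntegral ℤ p := by
    rw [← isIntegral_algebraMap_iff (B := ℂ) (algebraMap ℚ ℂ).injective]
    simpa [h] using hz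
  obtain ⟨m, hm⟩ := IsIntegrallyClosed.isIntegral_iff.1 h1
  refine ⟨m, ?_⟩
  rw [h, ← hm]
  simp

lemma exists_normSq_eq (d : ℕ) (x : ringOfInt d) :
    ∃ m : ℕ, Complex.normSq (algebraMap (ringOfInt d) ℂ x) = m := by
  obtain ⟨p, q, h⟩ := exists_rat_of_mem d (coe_mem d x)
  have hi := (coe_isIntegral d x).mul (conj_coe_isIntegral d x)
  obtain ⟨m, hm⟩ := exists_int_of_rat (p := p ^ 2 + d * q ^ 2) hi (by
    rw [h]
    simp only [map_add, map_mul, Complex.conj_I, Complex.conj_ofReal, map_ratCast]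
    push_cast
    linear_combination (-(q : ℂ) ^ 2) * I_sqrt_sq d)
  rw [Complex.mul_conj] at hm
  have hm' : Complex.normSq (algebraMap (ringOfInt d) ℂ x) = m := by exact_mod_cast hm
  have h0 : (0 : ℤ) ≤ m := by
    have := Complex.normSq_nonneg (algebraMap (ringOfInt d) ℂ x)
    rw [hm'] at this
    exact_mod_cast this
  exact ⟨m.toNat, by rw [hm']; exact_mod_cast (Int.toNat_of_nonneg h0).symm⟩

/-- A norm from `ℚ(√-d)` is a square modulo the ramified prime `d`. -/
lemma isSquare_normSq {d : ℕ} (hd : d.Prime) (hd3 : 3 ≤ d) (x : ringOfInt d) {N : ℕ}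
    (hN : Complex.normSq (algebraMap (ringOfInt d) ℂ x) = N) : IsSquare (N : ZMod d) := by
  have := Fact.mk hd
  obtain ⟨p, q, h⟩ := exists_rat_of_mem d (coe_mem d x)
  have hc : conj (algebraMap (ringOfInt d) ℂ x) = p - q * (Complex.I * (Real.sqrt d : ℂ)) := by
    rw [h]; simp [sub_eq_add_neg]
  have hx := coe_isIntegral d x
  have hx' := conj_coe_isIntegral d x
  have hNN : algebraMap (ringOfInt d) ℂ x * conj (algebraMap (ringOfInt d) ℂ x) = N := by
    rw [Complex.mul_conj, hN]; simp
  rw [hc, h] at hNN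
  -- the trace `2p` and `√-d` times the difference of the conjugates are rational integers
  obtain ⟨t, ht⟩ := exists_int_of_rat (p := 2 * p) (hx.add hx') (by rw [hc, h]; push_cast; ring)
  obtain ⟨e, he⟩ := exists_int_of_rat (p := -(2 * d * q))
    ((coe_isIntegral d (sqrtNeg d)).mul (hx.sub hx')) (by
      rw [hc, h, coe_sqrtNeg]; push_cast; linear_combination (2 * q : ℂ) * I_sqrt_sq d)
  rw [hc, h] at ht
  rw [hc, h, coe_sqrtNeg] at he
  have h1 : (d : ℤ) * (4 * N - t ^ 2) = e ^ 2 := by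
    have : (d : ℂ) * (4 * N - t ^ 2) = e ^ 2 := by
      rw [← ht, ← he, ← hNN]
      linear_combination (-4 * q ^ 2 * (Complex.I * (Real.sqrt d : ℂ)) ^ 2 : ℂ) * I_sqrt_sq d
    exact_mod_cast this
  have hdp : Prime (d : ℤ) := Nat.prime_iff_prime_int.1 hd
  obtain ⟨f, hf⟩ := hdp.dvd_of_dvd_pow (Dvd.intro _ h1)
  have h2 : (4 * N - t ^ 2 : ℤ) = d * f ^ 2 := by
    apply mul_left_cancel₀ hdp.ne_zero
    rw [h1, hf]; ring
  have h3 : (4 * N : ZMod d) = (t : ZMod d) ^ 2 := by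
    have := congrArg (Int.cast : ℤ → ZMod d) h2
    push_cast at this
    rw [ZMod.natCast_self, zero_mul, sub_eq_zero] at this
    exact this
  have h20 : (2 : ZMod d) ≠ 0 := by
    intro h0
    have : ((2 : ℕ) : ZMod d) = 0 := by exact_mod_cast h0
    rw [ZMod.natCast_eq_zero_iff] at this
    exact absurd (Nat.le_of_dvd two_pos this) (by omega)
  refine ⟨t / 2, ?_⟩
  field_simp
  linear_combination h3

/-- If `w` is the least non-residue, then `w - 1` is a nonzero square. -/
lemma exists_mul_sub_one_not_isSquare {d : ℕ} (hd : d.Prime) (hd3 : 3 ≤ d) :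
    ∃ w : ZMod d, ¬ IsSquare (w * (w - 1)) := by
  have := Fact.mk hd
  have hex : ∃ m : ℕ, ¬ IsSquare (m : ZMod d) := by
    obtain ⟨a, ha⟩ := FiniteField.exists_nonsquare (F := ZMod d) (by
      rw [ZMod.ringChar_zmod_n]; omega)
    obtain ⟨m, rfl⟩ := ZMod.natCast_zmod_surjective a
    exact ⟨m, ha⟩
  classical
  have hm := Nat.find_spec hex
  set m := Nat.find hex
  have hm0 : m ≠ 0 := by
    intro h; rw [h] at hm; simp at hm
  obtain ⟨s, hs⟩ : IsSquare ((m - 1 : ℕ) : ZMod d) := by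
    by_contra h
    exact Nat.find_min hex (Nat.sub_lt (Nat.pos_of_ne_zero hm0) one_pos) h
  rw [Nat.cast_sub (Nat.one_le_iff_ne_zero.2 hm0), Nat.cast_one] at hs
  have hs0 : s ≠ 0 := by
    rintro rfl
    apply hm
    rw [mul_zero, sub_eq_zero] at hs
    rw [hs]; exact IsSquare.one
  refine ⟨m, ?_⟩
  rintro ⟨r, hr⟩
  apply hm
  refine ⟨r / s, ?_⟩
  field_simp
  linear_combination hr - (m : ZMod d) * hs

/-- Infinitely many non-residues `D` for which `c + D N` is the norm of `-c N + s √-d`, for some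
integers `c` and `s = 1 + N u`. -/
lemma exists_radii {d : ℕ} (hd : d.Prime) (hd3 : 3 ≤ d) {N : ℕ} (hdN : ¬ d ∣ N)
    (hsq : IsSquare (N : ZMod d)) :
    ∃ D : ℕ → ℕ, Function.Injective D ∧ ∀ k, 0 < D k ∧ ¬ IsSquare (D k : ZMod d) ∧
      ∃ c u : ℤ, c ^ 2 * N ^ 2 + d * (1 + N * u) ^ 2 = c + D k * N := by
  have := Fact.mk hd
  obtain ⟨w, hw⟩ := exists_mul_sub_one_not_isSquare hd hd3
  obtain ⟨y, hy⟩ := hsq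
  have hN0 : (N : ZMod d) ≠ 0 := by rwa [Ne, ZMod.natCast_eq_zero_iff]
  have hy0 : y ≠ 0 := by rintro rfl; simp [hy] at hN0
  obtain ⟨v, hv⟩ := ZMod.intCast_surjective (w / (N : ZMod d) ^ 3)
  -- With `c = d + N v` the equation is solved by `D = c² N + 2 d u + d N u² - v`, which modulo `d`
  -- is `v (N³ v - 1)` whatever `u` is: `v` makes it a non-residue, and large `u` make it positive.
  set F : ℕ → ℤ := fun k => (d + N * v) ^ 2 * N + 2 * d * (v.natAbs + k + 1 : ℕ) +
    d * N * (v.natAbs + k + 1 : ℕ) ^ 2 - v with hF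
  have hdpos : (3 : ℤ) ≤ d := by exact_mod_cast hd3
  have hmono : StrictMono F := by
    apply strictMono_nat_of_lt_succ
    intro k
    simp only [hF]
    push_cast
    have h1 : (0 : ℤ) ≤ d * N := by positivity
    have h2 : (0 : ℤ) ≤ d * N * (|v| + k + 1) := by positivity
    nlinarith
  have hpos : ∀ k, 0 < F k := by
    intro k
    simp only [hF]
    push_cast
    have h1 : (0 : ℤ) ≤ (d + N * v) ^ 2 * N := by positivity
    have h2 : (0 : ℤ) ≤ d * N * (|v| + k + 1) ^ 2 := by positivity
    have h3 : (0 : ℤ) ≤ |v| + k := by positivity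
    have h4 := le_abs_self v
    nlinarith
  have hcast : ∀ k, (((F k).toNat : ℕ) : ℤ) = F k := fun k => Int.toNat_of_nonneg (hpos k).le
  refine ⟨fun k => (F k).toNat, ?_, fun k => ⟨?_, ?_, d + N * v, (v.natAbs + k + 1 : ℕ), ?_⟩⟩
  · intro i j hij
    apply hmono.injective
    rw [← hcast i, ← hcast j]
    exact congrArg _ hij
  · exact Int.pos_iff_toNat_pos.1 (hpos k)
  · rintro ⟨r, hr⟩
    apply hw
    have h1 : (((F k).toNat : ℕ) : ZMod d) = v * (N ^ 3 * v - 1) := by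
      rw [← Int.cast_natCast, hcast]
      simp only [hF]
      push_cast
      simp only [ZMod.natCast_self]
      ring
    refine ⟨r * y ^ 3, ?_⟩
    have h2 : w = v * (N : ZMod d) ^ 3 := by rw [hv]; field_simp
    rw [h1] at hr
    have h3 : (N : ZMod d) ^ 3 = y ^ 6 := by rw [hy]; ring
    rw [h2]
    linear_combination (N : ZMod d) ^ 3 * hr + r * r * h3
  · rw [hcast]
    simp only [hF]
    push_cast
    ring

/-! ### The order `ℤ[√-d] ⊕ ℤ[√-d] j`, `j² = D`, and its reduction theory -/

/-- The embedding of `ℤ[√-d]` into `O_d`. -/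
def ofZsqrtd (d : ℕ) : ℤ√(-d : ℤ) →+* ringOfInt d :=
  Zsqrtd.lift ⟨sqrtNeg d, by rw [← pow_two, sqrtNeg_sq]; simp⟩

/-- The embedding of `ℤ[√-d]` into `ℂ`. -/
def zc (d : ℕ) : ℤ√(-d : ℤ) →+* ℂ := (algebraMap (ringOfInt d) ℂ).comp (ofZsqrtd d)

lemma zc_apply (d : ℕ) (a : ℤ√(-d : ℤ)) :
    zc d a = a.re + a.im * (Complex.I * (Real.sqrt d : ℂ)) := by
  simp [zc, ofZsqrtd, Zsqrtd.lift, coe_sqrtNeg]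

lemma zc_star (d : ℕ) (a : ℤ√(-d : ℤ)) : zc d (star a) = conj (zc d a) := by
  simp [zc_apply]

lemma normSq_zc (d : ℕ) (a : ℤ√(-d : ℤ)) : Complex.normSq (zc d a) = a.norm := by
  have h : Real.sqrt d * Real.sqrt d = d := Real.mul_self_sqrt (Nat.cast_nonneg d)
  rw [zc_apply, Complex.normSq_apply, Zsqrtd.norm]
  simp
  linear_combination (a.im * a.im : ℝ) * h

lemma norm_coe_eq (d : ℕ) (a : ℤ√(-d : ℤ)) : a.norm = a.re ^ 2 + d * a.im ^ 2 := by
  rw [Zsqrtd.norm]; ring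

/-- Infinite descent: a common zero of the anisotropic form `p² + d q² - D (r² + d s²)` is
divisible by every power of `d`. -/
lemma dvd_of_form_eq_zero {d D : ℕ} (hd : d.Prime) (hD : ¬ IsSquare (D : ZMod d)) (n : ℕ) :
    ∀ p q r s : ℤ, p ^ 2 + d * q ^ 2 = D * (r ^ 2 + d * s ^ 2) →
      (d : ℤ) ^ n ∣ r ∧ (d : ℤ) ^ n ∣ s := by
  have := Fact.mk hd
  have hd0 : (d : ℤ) ≠ 0 := by exact_mod_cast hd.ne_zero
  have step : ∀ p q r s : ℤ, p ^ 2 + d * q ^ 2 = D * (r ^ 2 + d * s ^ 2) →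
      ∃ p' r' : ℤ, p = d * p' ∧ r = d * r' ∧
        q ^ 2 + d * p' ^ 2 = D * (s ^ 2 + d * r' ^ 2) := by
    intro p q r s h
    have h1 := congrArg (Int.cast : ℤ → ZMod d) h
    push_cast at h1
    simp only [ZMod.natCast_self, zero_mul, add_zero] at h1
    have hr : (r : ZMod d) = 0 := by
      by_contra hr
      exact hD ⟨p / r, by field_simp; linear_combination -h1⟩
    have hp : (p : ZMod d) = 0 := by
      rw [hr] at h1
      simpa using h1
    obtain ⟨r', rfl⟩ := (ZMod.intCast_zmod_eq_zero_iff_dvd _ _).1 hr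
    obtain ⟨p', rfl⟩ := (ZMod.intCast_zmod_eq_zero_iff_dvd _ _).1 hp
    refine ⟨p', r', rfl, rfl, ?_⟩
    apply mul_left_cancel₀ hd0
    linear_combination h
  induction n with
  | zero => simp
  | succ n ih =>
    intro p q r s h
    obtain ⟨p', r', rfl, rfl, h1⟩ := step p q r s h
    obtain ⟨q', s', rfl, rfl, h2⟩ := step q p' s r' h1
    obtain ⟨hr, hs⟩ := ih p' q' r' s' h2
    rw [pow_succ']
    exact ⟨mul_dvd_mul_left _ hr, mul_dvd_mul_left _ hs⟩

lemma eq_zero_of_forall_pow_dvd {d : ℕ} (hd : 1 < d) {x : ℤ}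
    (h : ∀ n : ℕ, (d : ℤ) ^ n ∣ x) :
    x = 0 := by
  apply Int.eq_zero_of_abs_lt_dvd (h x.natAbs)
  rw [Int.abs_eq_natAbs]
  exact_mod_cast Nat.lt_pow_self hd

/-- The reduced norm of the quaternion algebra `(-d, D)` is anisotropic. -/
lemma nrd_ne_zero {d D : ℕ} (hd : d.Prime) (hD : ¬ IsSquare (D : ZMod d))
    {a c : ℤ√(-d : ℤ)} (hc : c ≠ 0) : a.norm - D * c.norm ≠ 0 := by
  intro h
  rw [norm_coe_eq, norm_coe_eq, sub_eq_zero] at h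
  apply hc
  ext
  · exact eq_zero_of_forall_pow_dvd hd.one_lt fun n => (dvd_of_form_eq_zero hd hD n _ _ _ _ h).1
  · exact eq_zero_of_forall_pow_dvd hd.one_lt fun n => (dvd_of_form_eq_zero hd hD n _ _ _ _ h).2

/-- Dirichlet's approximation theorem for `ℤ[√-d]`. -/
lemma exists_approx {d : ℕ} (hd : 0 < d) (w : ℂ) {Q : ℕ} (hQ : 0 < Q) :
    ∃ a c : ℤ√(-d : ℤ), c ≠ 0 ∧ Complex.normSq (zc d c) ≤ (1 + d) * Q ^ 2 ∧
      Complex.normSq (zc d a - w * zc d c) ≤ (1 + d) / Q ^ 2 := by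
  have hs : 0 < Real.sqrt d := Real.sqrt_pos.2 (by exact_mod_cast hd)
  have hss : Real.sqrt d * Real.sqrt d = d := Real.mul_self_sqrt (Nat.cast_nonneg d)
  have hQ' : (0 : ℝ) < Q := by exact_mod_cast hQ
  let e : ℕ × ℕ → ℤ√(-d : ℤ) := fun m => ⟨m.1, m.2⟩
  let X : ℕ × ℕ → ℝ := fun m => (w * zc d (e m)).re
  let Y : ℕ × ℕ → ℝ := fun m => (w * zc d (e m)).im / Real.sqrt d
  let box : ℕ × ℕ → ℕ × ℕ := fun m => (⌊Q * Int.fract (X m)⌋₊, ⌊Q * Int.fract (Y m)⌋₊)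
  have hlt : ∀ x : ℝ, ⌊Q * Int.fract x⌋₊ < Q := fun x => by
    rw [Nat.floor_lt (mul_nonneg hQ'.le (Int.fract_nonneg x))]
    exact mul_lt_of_lt_one_right hQ' (Int.fract_lt_one x)
  obtain ⟨m, hm, m', hm', hne, heq⟩ := Finset.exists_ne_map_eq_of_card_lt_of_maps_to
    (s := Finset.range (Q + 1) ×ˢ Finset.range (Q + 1)) (t := Finset.range Q ×ˢ Finset.range Q)
    (f := box) (by simp only [Finset.card_product, Finset.card_range]; nlinarith) (by
      intro m _
      simp only [box, Finset.coe_product, Finset.coe_range, Set.mem_prod, Set.mem_Iio]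
      exact ⟨hlt _, hlt _⟩)
  simp only [Finset.mem_product, Finset.mem_range] at hm hm'
  simp only [box, Prod.mk.injEq] at heq
  have hfr : ∀ x y : ℝ, ⌊Q * Int.fract x⌋₊ = ⌊Q * Int.fract y⌋₊ →
      (Int.fract x - Int.fract y) ^ 2 ≤ 1 / Q ^ 2 := by
    intro x y h
    have h1 := Nat.floor_le (mul_nonneg hQ'.le (Int.fract_nonneg x))
    have h2 := Nat.lt_floor_add_one (Q * Int.fract x)
    have h3 := Nat.floor_le (mul_nonneg hQ'.le (Int.fract_nonneg y))
    have h4 := Nat.lt_floor_add_one (Q * Int.fract y)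
    rw [h] at h1 h2
    rw [le_div_iff₀ (by positivity), ← mul_pow, sq_le_one_iff_abs_le_one, abs_le]
    constructor <;> nlinarith
  have h1 := hfr _ _ heq.1
  have h2 := hfr _ _ heq.2
  refine ⟨⟨⌊X m⌋ - ⌊X m'⌋, ⌊Y m⌋ - ⌊Y m'⌋⟩, e m - e m', ?_, ?_, ?_⟩
  · intro h
    apply hne
    have h0 := sub_eq_zero.1 h
    simp only [e, Zsqrtd.ext_iff, Nat.cast_inj] at h0
    exact Prod.ext h0.1 h0.2
  · rw [normSq_zc, norm_coe_eq]
    simp only [e, Zsqrtd.re_sub, Zsqrtd.im_sub]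
    push_cast
    have hb : ∀ x y : ℕ, x < Q + 1 → y < Q + 1 → ((x : ℝ) - y) ^ 2 ≤ Q ^ 2 := by
      intro x y hx hy
      have hx' : (x : ℝ) ≤ Q := by exact_mod_cast Nat.lt_succ_iff.1 hx
      have hy' : (y : ℝ) ≤ Q := by exact_mod_cast Nat.lt_succ_iff.1 hy
      have hx0 : (0 : ℝ) ≤ x := Nat.cast_nonneg x
      have hy0 : (0 : ℝ) ≤ y := Nat.cast_nonneg y
      apply sq_le_sq' <;> linarith
    have b1 := hb _ _ hm.1 hm'.1
    have b2 := mul_le_mul_of_nonneg_left (hb _ _ hm.2 hm'.2) (Nat.cast_nonneg (α := ℝ) d)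
    linarith
  · have hre : (zc d ⟨⌊X m⌋ - ⌊X m'⌋, ⌊Y m⌋ - ⌊Y m'⌋⟩ - w * zc d (e m - e m')).re =
        -(Int.fract (X m) - Int.fract (X m')) := by
      rw [map_sub, mul_sub, Complex.sub_re, Complex.sub_re]
      change _ - (X m - X m') = _
      rw [zc_apply]
      simp
      simp only [Int.fract]
      ring
    have him : (zc d ⟨⌊X m⌋ - ⌊X m'⌋, ⌊Y m⌋ - ⌊Y m'⌋⟩ - w * zc d (e m - e m')).im =
        -(Int.fract (Y m) - Int.fract (Y m')) * Real.sqrt d := by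
      rw [map_sub, mul_sub, Complex.sub_im, Complex.sub_im]
      have hY : ∀ m, (w * zc d (e m)).im = Y m * Real.sqrt d := fun m =>
        (div_mul_cancel₀ _ hs.ne').symm
      rw [hY, hY, zc_apply]
      simp
      simp only [Int.fract]
      ring
    rw [Complex.normSq_apply, hre, him, add_div]
    have h3 := mul_le_mul_of_nonneg_left h2 (Nat.cast_nonneg (α := ℝ) d)
    have h4 : (d : ℝ) / Q ^ 2 = d * (1 / Q ^ 2) := by ring
    rw [h4]
    calc _ = (Int.fract (X m) - Int.fract (X m')) ^ 2 +
          (Real.sqrt d * Real.sqrt d) * (Int.fract (Y m) - Int.fract (Y m')) ^ 2 := by ring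
      _ ≤ _ := by rw [hss]; linarith

lemma normSq_add_le (x y : ℂ) :
    Complex.normSq (x + y) ≤ 2 * (Complex.normSq x + Complex.normSq y) := by
  simp only [Complex.normSq_apply, Complex.add_re, Complex.add_im]
  nlinarith [sq_nonneg (x.re - y.re), sq_nonneg (x.im - y.im)]

/-- Every unimodular translate of the lattice `ℤ[√-d]²` contains a vector of bounded size whose
second coordinate in the lattice is nonzero. -/
lemma exists_short_vector {d D : ℕ} (hd : 0 < d) (hD : 0 < D) {A B : ℂ}
    (h : Complex.normSq A - D * Complex.normSq B = 1) :
    ∃ a c : ℤ√(-d : ℤ), c ≠ 0 ∧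
      Complex.normSq (conj A * zc d a - D * conj B * zc d c) ≤ 10 * (1 + d) ∧
      Complex.normSq (A * zc d c - B * zc d a) ≤ 10 * (1 + d) := by
  have hD1 : (1 : ℝ) ≤ D := by exact_mod_cast hD
  have hB0 := Complex.normSq_nonneg B
  have hA1 : 1 ≤ Complex.normSq A := by nlinarith
  have hBA : Complex.normSq B ≤ Complex.normSq A := by nlinarith
  have hA0 : A ≠ 0 := by rintro rfl; simp at hA1; linarith
  have hcA0 : conj A ≠ 0 := by simpa using hA0
  have hnA : 1 ≤ ‖A‖ := by
    rw [Complex.normSq_eq_norm_sq] at hA1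
    nlinarith [norm_nonneg A]
  -- for this slope and `Q ≈ |A|`, both coordinates of the translated vector are bounded
  obtain ⟨a, c, hc, h1, h2⟩ := exists_approx hd (D * conj B / conj A) (Q := ⌈‖A‖⌉₊)
    (Nat.ceil_pos.2 (by linarith))
  have hQ1 : ‖A‖ ≤ ⌈‖A‖⌉₊ := Nat.le_ceil _
  have hQ2 : (⌈‖A‖⌉₊ : ℝ) ≤ 2 * ‖A‖ := by
    have := Nat.ceil_lt_add_one (norm_nonneg A)
    linarith
  set Q : ℝ := ((⌈‖A‖⌉₊ : ℕ) : ℝ)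
  have hQ0 : 0 < Q := by linarith
  have hAQ : Complex.normSq A ≤ Q ^ 2 := by rw [Complex.normSq_eq_norm_sq]; gcongr
  have hQA : Q ^ 2 ≤ 4 * Complex.normSq A := by
    rw [Complex.normSq_eq_norm_sq]; nlinarith
  set ε := zc d a - D * conj B / conj A * zc d c
  have hε : ∀ x : ℝ, 0 ≤ x → x ≤ Q ^ 2 → x * Complex.normSq ε ≤ 1 + d := by
    intro x hx0 hx
    rw [le_div_iff₀ (by positivity)] at h2
    nlinarith [Complex.normSq_nonneg ε]
  have hd0 : (0 : ℝ) ≤ d := Nat.cast_nonneg d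
  refine ⟨a, c, hc, ?_, ?_⟩
  · have : conj A * zc d a - D * conj B * zc d c = conj A * ε := by
      simp only [ε]; field_simp
    rw [this, map_mul, Complex.normSq_conj]
    linarith [hε _ (by linarith) hAQ]
  · have hA : A * conj A = D * (B * conj B) + 1 := by
      rw [Complex.mul_conj, Complex.mul_conj]
      have : Complex.normSq A = D * Complex.normSq B + 1 := by linarith
      rw [this]; push_cast; ring
    have : A * zc d c - B * zc d a = -B * ε + zc d c / conj A := by
      simp only [ε]
      field_simp
      linear_combination zc d c * hA
    rw [this]
    refine (normSq_add_le _ _).trans ?_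
    rw [map_mul, map_div₀, Complex.normSq_neg, Complex.normSq_conj]
    have e1 := hε _ hB0 (hBA.trans hAQ)
    have e2 : Complex.normSq (zc d c) / Complex.normSq A ≤ 4 * (1 + d) := by
      rw [div_le_iff₀ (by linarith)]
      nlinarith
    linarith

/-- Reduction theory for the norm-one group of the order `ℤ[√-d] ⊕ ℤ[√-d] j`, `j² = D`: a
unimodular element can be moved by a unit of the order into a bounded set. -/
lemma exists_bounded_representative {d D : ℕ} (hd : d.Prime) (hD : ¬ IsSquare (D : ZMod d)) :
    ∃ M : ℝ, ∀ A B : ℂ, Complex.normSq A - D * Complex.normSq B = 1 →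
      ∃ a c : ℤ√(-d : ℤ), a.norm - D * c.norm = 1 ∧
        Complex.normSq (conj (zc d a) * A - D * conj (zc d c) * B) ≤ M := by
  have hD0 : 0 < D := Nat.pos_of_ne_zero (by rintro rfl; simp at hD)
  -- Short vectors have reduced norm at most `nmax` in absolute value; `key` records the reduced
  -- norm `n` and the coordinates modulo `n`, and `rep` picks a vector for each of the finitely many
  -- values of `key`.
  let R : ℝ := 10 * (1 + d)
  let nmax : ℤ := ⌈(1 + D) * R⌉
  let key : ℤ√(-d : ℤ) × ℤ√(-d : ℤ) → ℤ × ℤ × ℤ × ℤ × ℤ := fun l =>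
    let n := l.1.norm - D * l.2.norm
    (n, l.1.re % n, l.1.im % n, l.2.re % n, l.2.im % n)
  let T : Set (ℤ√(-d : ℤ) × ℤ√(-d : ℤ)) := {l | l.1.norm - D * l.2.norm ≠ 0 ∧
    |l.1.norm - D * l.2.norm| ≤ nmax}
  let K : Set (ℤ × ℤ × ℤ × ℤ × ℤ) := Set.Icc (-nmax) nmax ×ˢ Set.Icc 0 nmax ×ˢ Set.Icc 0 nmax ×ˢ
    Set.Icc 0 nmax ×ˢ Set.Icc 0 nmax
  have hK : K.Finite := by
    simp only [K]
    exact (Set.finite_Icc _ _).prod ((Set.finite_Icc _ _).prod ((Set.finite_Icc _ _).prod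
      ((Set.finite_Icc _ _).prod (Set.finite_Icc _ _))))
  have hkey : ∀ l ∈ T, key l ∈ K := by
    rintro l ⟨h0, hl⟩
    have hmod : ∀ x : ℤ, x % (l.1.norm - D * l.2.norm) ∈ Set.Icc 0 nmax := fun x =>
      ⟨Int.emod_nonneg _ h0, ((Int.emod_lt_abs _ h0).le).trans hl⟩
    exact ⟨abs_le.1 hl, hmod _, hmod _, hmod _, hmod _⟩
  let rep := Function.invFunOn key T
  obtain ⟨M, hM⟩ := (hK.image fun k => 2 * (Complex.normSq (zc d (rep k).1) * R +
    D ^ 2 * (Complex.normSq (zc d (rep k).2) * R))).bddAbove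
  refine ⟨M, fun A B h => ?_⟩
  obtain ⟨a, c, hc, h1, h2⟩ := exists_short_vector hd.pos hD0 h
  change _ ≤ R at h1 h2
  have hn0 := nrd_ne_zero hd hD (a := a) hc
  set s0 := conj A * zc d a - D * conj B * zc d c with hs0
  set s1 := A * zc d c - B * zc d a with hs1
  -- the reduced norm of the short vector, computed in the two frames
  have hn : ((a.norm - D * c.norm : ℤ) : ℝ) = Complex.normSq s0 - D * Complex.normSq s1 := by
    push_cast
    rw [← normSq_zc, ← normSq_zc]
    simp only [hs0, hs1, Complex.normSq_apply] at h ⊢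
    simp
    linear_combination (-((zc d a).re * (zc d a).re + (zc d a).im * (zc d a).im) +
      D * ((zc d c).re * (zc d c).re + (zc d c).im * (zc d c).im)) * h
  have hT : (a, c) ∈ T := by
    refine ⟨hn0, ?_⟩
    have : |((a.norm - D * c.norm : ℤ) : ℝ)| ≤ nmax := by
      refine le_trans ?_ (Int.le_ceil _)
      rw [hn, abs_le]
      have := Complex.normSq_nonneg s0
      have := Complex.normSq_nonneg s1
      have hD' : (0 : ℝ) ≤ D := Nat.cast_nonneg D
      constructor <;> nlinarith
    exact_mod_cast this
  have hex : ∃ l ∈ T, key l = key (a, c) := ⟨_, hT, rfl⟩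
  have hrep : key (rep (key (a, c))) = key (a, c) := Function.invFunOn_eq hex
  have hMk := hM (Set.mem_image_of_mem _ (hkey _ hT))
  generalize rep (key (a, c)) = l at hrep hMk
  obtain ⟨a', c'⟩ := l
  simp only [key, Prod.mk.injEq] at hrep
  dsimp only at hMk
  obtain ⟨hn', m1, m2, m3, m4⟩ := hrep
  rw [hn'] at m1 m2 m3 m4
  set n : ℤ := a.norm - D * c.norm
  obtain ⟨x1, m1⟩ := Int.ModEq.dvd m1
  obtain ⟨x2, m2⟩ := Int.ModEq.dvd m2
  obtain ⟨x3, m3⟩ := Int.ModEq.dvd m3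
  obtain ⟨x4, m4⟩ := Int.ModEq.dvd m4
  obtain ⟨x, hx⟩ : ∃ x : ℤ√(-d : ℤ), a = a' + (n : ℤ√(-d : ℤ)) * x := by
    refine ⟨⟨x1, x2⟩, ?_⟩
    ext <;> simp <;> linarith
  obtain ⟨y, hy⟩ : ∃ y : ℤ√(-d : ℤ), c = c' + (n : ℤ√(-d : ℤ)) * y := by
    refine ⟨⟨x3, x4⟩, ?_⟩
    ext <;> simp <;> linarith
  have hN : a * star a - D * (c * star c) = (n : ℤ√(-d : ℤ)) := by
    rw [← Zsqrtd.norm_eq_mul_conj, ← Zsqrtd.norm_eq_mul_conj]; simp [n]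
  have hN' : a' * star a' - D * (c' * star c') = (n : ℤ√(-d : ℤ)) := by
    rw [← hn', ← Zsqrtd.norm_eq_mul_conj, ← Zsqrtd.norm_eq_mul_conj]; simp
  -- the quotient of the two congruent vectors of the same reduced norm is integral
  obtain ⟨α, hα⟩ : ∃ α : ℤ√(-d : ℤ), a * star a' - D * (star c * c') = n * α := by
    refine ⟨1 + x * star a' - D * (star y * c'), ?_⟩
    rw [hx, hy]
    simp only [star_add, star_mul, star_intCast]
    linear_combination hN'
  obtain ⟨γ, hγ⟩ : ∃ γ : ℤ√(-d : ℤ), c * star a' - star a * c' = n * γ := by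
    refine ⟨y * star a' - star x * c', ?_⟩
    rw [hx, hy]
    simp only [star_add, star_mul, star_intCast]
    ring
  have hα' : star a * a' - D * (c * star c') = n * star α := by
    have := congrArg star hα
    simp only [star_sub, star_mul, star_intCast, star_natCast, star_star] at this
    linear_combination this
  have hγ' : star c * a' - a * star c' = n * star γ := by
    have := congrArg star hγ
    simp only [star_sub, star_mul, star_intCast, star_star] at this
    linear_combination this
  refine ⟨α, γ, ?_, ?_⟩
  · have h3 : (n : ℤ√(-d : ℤ)) ^ 2 * (α * star α - D * (γ * star γ)) = n ^ 2 * 1 := by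
      calc _ = (n * α) * (n * star α) - D * ((n * γ) * (n * star γ)) := by ring
        _ = (a * star a - D * (c * star c)) * (a' * star a' - D * (c' * star c')) := by
            rw [← hα, ← hγ, ← hα', ← hγ']; ring
        _ = _ := by rw [hN, hN']; ring
    rw [← Zsqrtd.norm_eq_mul_conj, ← Zsqrtd.norm_eq_mul_conj] at h3
    exact mul_left_cancel₀ (pow_ne_zero 2 hn0) (by exact_mod_cast h3)
  · have e1 := congrArg (zc d) hα'
    have e2 := congrArg (zc d) hγ'
    simp only [map_sub, map_mul, map_intCast, map_natCast, zc_star] at e1 e2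
    have e3 : (n : ℂ) * (conj (zc d α) * A - D * conj (zc d γ) * B) =
        zc d a' * conj s0 + -D * (conj (zc d c') * s1) := by
      simp only [hs0, hs1, map_sub, map_mul, Complex.conj_conj, map_natCast]
      linear_combination -A * e1 + D * B * e2
    have e4 : (1 : ℝ) ≤ (n : ℝ) ^ 2 := by
      have : 1 ≤ n ^ 2 := by
        have := sq_pos_of_ne_zero hn0
        omega
      exact_mod_cast this
    set z := conj (zc d α) * A - D * conj (zc d γ) * B
    have e5 : (n : ℝ) ^ 2 * Complex.normSq z =
        Complex.normSq (zc d a' * conj s0 + -D * (conj (zc d c') * s1)) := by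
      rw [← e3, map_mul, Complex.normSq_intCast, pow_two]
    have e6 := normSq_add_le (zc d a' * conj s0) (-D * (conj (zc d c') * s1))
    simp only [map_mul, Complex.normSq_conj, Complex.normSq_neg, Complex.normSq_natCast] at e6
    have e7 := mul_le_mul_of_nonneg_left h1 (Complex.normSq_nonneg (zc d a'))
    have e8 := mul_le_mul_of_nonneg_left (mul_le_mul_of_nonneg_left h2
      (Complex.normSq_nonneg (zc d c'))) (sq_nonneg (D : ℝ))
    nlinarith [Complex.normSq_nonneg z]

/-! ### Integral points of the stabilizer -/

section Inverse

variable {R : Type*} [CommRing R] (A : SL(2, R))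

lemma SL2_inv_zero_zero : A⁻¹ 0 0 = A 1 1 := by
  simp [Matrix.SpecialLinearGroup.coe_inv, Matrix.adjugate_fin_two]

lemma SL2_inv_zero_one : A⁻¹ 0 1 = -A 0 1 := by
  simp [Matrix.SpecialLinearGroup.coe_inv, Matrix.adjugate_fin_two]

lemma SL2_inv_one_zero : A⁻¹ 1 0 = -A 1 0 := by
  simp [Matrix.SpecialLinearGroup.coe_inv, Matrix.adjugate_fin_two]

lemma SL2_inv_one_one : A⁻¹ 1 1 = A 0 0 := by
  simp [Matrix.SpecialLinearGroup.coe_inv, Matrix.adjugate_fin_two]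

end Inverse

/-- The element of `SL₂(O_d)` with rows `(a, D c̄)` and `(c, ā)`, for `a, c ∈ ℤ[√-d]`. -/
def orderUnit {d D : ℕ} (a c : ℤ√(-d : ℤ)) (h : a.norm - D * c.norm = 1) : SL(2, ringOfInt d) :=
  ⟨!![ofZsqrtd d a, D * ofZsqrtd d (star c); ofZsqrtd d c, ofZsqrtd d (star a)], by
    have h1 : a * star a - D * star c * c = (1 : ℤ√(-d : ℤ)) := by
      rw [mul_assoc, mul_comm (star c), ← Zsqrtd.norm_eq_mul_conj, ← Zsqrtd.norm_eq_mul_conj]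
      exact_mod_cast h
    rw [Matrix.det_fin_two_of, ← map_mul, ← map_natCast (ofZsqrtd d), ← map_mul, ← map_mul,
      ← map_sub, h1, map_one]⟩

lemma incl_P (d : ℕ) (A : SL(2, ringOfInt d)) : incl d (P (ringOfInt d) A) =
    P ℂ (Matrix.SpecialLinearGroup.map (algebraMap (ringOfInt d) ℂ) A) := rfl

lemma mem_bianchiStab {d D : ℕ} (A : SL(2, ringOfInt d))
    (h0 : A 1 1 = conjInt d (A 0 0)) (h1 : A 0 1 = D * conjInt d (A 1 0)) :
    P _ A ∈ bianchiStab d (circleOf D) := by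
  rw [bianchiStab, Subgroup.mem_comap, incl_P]
  apply P_mem_circleStab
  · simp [h0, coe_conjInt]
  · simp [h1, coe_conjInt]

lemma conjInt_ofZsqrtd (d : ℕ) (a : ℤ√(-d : ℤ)) :
    conjInt d (ofZsqrtd d a) = ofZsqrtd d (star a) := by
  apply algebraMap_injective d
  rw [coe_conjInt]
  exact (zc_star d a).symm

lemma orderUnit_mem_bianchiStab {d D : ℕ} (a c : ℤ√(-d : ℤ)) (h : a.norm - D * c.norm = 1) :
    P _ (orderUnit a c h) ∈ bianchiStab d (circleOf D) :=
  mem_bianchiStab _ (by simp [orderUnit, conjInt_ofZsqrtd]) (by simp [orderUnit, conjInt_ofZsqrtd])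

/-! ### Discreteness of the Bianchi group -/

lemma eq_zero_of_normSq_lt_one {d : ℕ} {x : ringOfInt d}
    (h : Complex.normSq (algebraMap (ringOfInt d) ℂ x) < 1) : x = 0 := by
  obtain ⟨m, hm⟩ := exists_normSq_eq d x
  rw [hm] at h
  have hm0 : m = 0 := by
    have : m < 1 := by exact_mod_cast h
    omega
  rw [hm0, Nat.cast_zero, Complex.normSq_eq_zero] at hm
  exact (map_eq_zero_iff _ (algebraMap_injective d)).1 hm

/-- An element of the Bianchi group that is congruent modulo the centre to a complex matrix near
the identity is trivial. -/
lemma incl_eq_one_of_near {d : ℕ} (A : SL(2, ringOfInt d)) (B : SL(2, ℂ))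
    (hAB : incl d (P _ A) = P ℂ B)
    (hB : ∀ i j, ‖B i j - (1 : Matrix (Fin 2) (Fin 2) ℂ) i j‖ < 1) : P _ A = 1 := by
  rw [incl_P] at hAB
  have h1 := QuotientGroup.eq.1 hAB
  rw [Matrix.SpecialLinearGroup.mem_center_iff] at h1
  obtain ⟨r, hr, h1⟩ := h1
  have hr' : r = 1 ∨ r = -1 := by simpa using hr
  have hBA : ∀ i j, B i j = r * algebraMap (ringOfInt d) ℂ (A i j) := by
    have h2 : (B : Matrix (Fin 2) (Fin 2) ℂ) =
        (Matrix.SpecialLinearGroup.map (algebraMap (ringOfInt d) ℂ) A :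
          Matrix (Fin 2) (Fin 2) ℂ) * Matrix.scalar (Fin 2) r := by
      rw [h1, ← Matrix.SpecialLinearGroup.coe_mul, mul_inv_cancel_left]
    intro i j
    rw [h2, Matrix.scalar_apply, Matrix.mul_diagonal, mul_comm]
    rfl
  obtain ⟨s, hs, hs2⟩ : ∃ s : ringOfInt d, algebraMap (ringOfInt d) ℂ s = r ∧ s ^ 2 = 1 := by
    rcases hr' with rfl | rfl
    · exact ⟨1, by simp⟩
    · exact ⟨-1, by simp⟩
  have hA : ∀ i j, s * A i j = (1 : Matrix (Fin 2) (Fin 2) (ringOfInt d)) i j := by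
    intro i j
    rw [← sub_eq_zero]
    apply eq_zero_of_normSq_lt_one
    rw [Complex.normSq_eq_norm_sq, sq_lt_one_iff₀ (norm_nonneg _)]
    have h3 : algebraMap (ringOfInt d) ℂ ((1 : Matrix (Fin 2) (Fin 2) (ringOfInt d)) i j) =
        (1 : Matrix (Fin 2) (Fin 2) ℂ) i j := by
      rw [Matrix.one_apply, Matrix.one_apply]
      split_ifs <;> simp
    rw [map_sub, map_mul, hs, h3, ← hBA]
    exact hB i j
  refine (QuotientGroup.eq_one_iff _).2 ?_
  rw [Matrix.SpecialLinearGroup.mem_center_iff]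
  refine ⟨s, by simpa using hs2, ?_⟩
  ext i j
  have := congrArg (s * ·) (hA i j)
  simp only [← mul_assoc, ← pow_two, hs2, one_mul] at this
  rw [this, Matrix.scalar_apply, Matrix.diagonal_apply, Matrix.one_apply]
  split_ifs <;> simp

/-- Every subgroup of the Bianchi group is discrete in `PSL₂(ℂ)`. -/
lemma discreteTopology_map_incl {d : ℕ} (H : Subgroup (PSL2 (ringOfInt d))) :
    DiscreteTopology (H.map (incl d)) := by
  apply discreteTopology_of_isOpen_singleton_one
  let U : Set SL(2, ℂ) := {B | ∀ i j, ‖B i j - (1 : Matrix (Fin 2) (Fin 2) ℂ) i j‖ < 1}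
  have hU : IsOpen U := by
    have : U = ⋂ i, ⋂ j, {B : SL(2, ℂ) | ‖B i j - (1 : Matrix (Fin 2) (Fin 2) ℂ) i j‖ < 1} := by
      ext; simp [U]
    rw [this]
    refine isOpen_iInter_of_finite fun i => isOpen_iInter_of_finite fun j => ?_
    exact isOpen_lt (by fun_prop) continuous_const
  have hPU : IsOpen (P ℂ '' U) := QuotientGroup.isOpenMap_coe _ hU
  refine ⟨P ℂ '' U, hPU, ?_⟩
  ext ⟨x, hx⟩
  simp only [Set.mem_preimage, Set.mem_singleton_iff]
  constructor
  · rintro ⟨B, hB, hBx⟩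
    obtain ⟨y, hy, rfl⟩ := hx
    obtain ⟨A, rfl⟩ := QuotientGroup.mk_surjective y
    apply Subtype.ext
    have := incl_eq_one_of_near A B hBx.symm hB
    change incl d (P _ A) = 1
    rw [this, map_one]
  · intro h
    refine ⟨1, by simp [U], ?_⟩
    rw [map_one]
    exact (congrArg Subtype.val h).symm

/-! ### The real model and the compact quotient -/

/-- A matrix of determinant one whose Möbius transformation maps `C_D` to the real line and `0`
to `i`: the scaling that carries `C_D` to the unit circle, followed by a Cayley transform. -/
def cayley (D : ℕ) (hD : 0 < D) : SL(2, ℂ) :=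
  ⟨(Real.sqrt 2 : ℂ)⁻¹ • !![(Real.sqrt (Real.sqrt D) : ℂ)⁻¹, Complex.I * Real.sqrt (Real.sqrt D);
      Complex.I * (Real.sqrt (Real.sqrt D) : ℂ)⁻¹, Real.sqrt (Real.sqrt D)], by
    have h : (Real.sqrt (Real.sqrt D) : ℂ) ≠ 0 := by
      exact_mod_cast (Real.sqrt_pos.2 (Real.sqrt_pos.2 (by exact_mod_cast hD))).ne'
    have h2 : (Real.sqrt 2 : ℂ) ≠ 0 := by
      exact_mod_cast (Real.sqrt_pos.2 two_pos).ne'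
    have h3 : (Real.sqrt 2 : ℂ) ^ 2 = 2 := by
      exact_mod_cast Real.sq_sqrt (zero_le_two (α := ℝ))
    rw [Matrix.det_smul, Matrix.det_fin_two_of]
    simp only [Fintype.card_fin, inv_pow, h3]
    field_simp
    rw [Complex.I_sq]
    norm_num⟩

lemma cayley_smul_circleOf (D : ℕ) (hD : 0 < D) :
    P ℂ (cayley D hD) • circleOf D = realCircle := by
  have hr : 0 < Real.sqrt D := Real.sqrt_pos.2 (by exact_mod_cast hD)
  set ρ := Real.sqrt (Real.sqrt D) with hρ
  have hρ0 : 0 < ρ := Real.sqrt_pos.2 hr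
  have hρ4 : ρ ^ 4 = D := by
    rw [show ρ ^ 4 = (ρ ^ 2) ^ 2 by ring, hρ, Real.sq_sqrt hr.le, Real.sq_sqrt (Nat.cast_nonneg D)]
  have hρc : (ρ : ℂ) ≠ 0 := by exact_mod_cast hρ0.ne'
  have h2 : (Real.sqrt 2 : ℂ) ≠ 0 := by exact_mod_cast (Real.sqrt_pos.2 two_pos).ne'
  ext p
  rw [Set.mem_smul_set_iff_inv_smul_mem, mem_circleOf_iff, ← map_inv]
  have e00 : (cayley D hD)⁻¹ 0 0 = (Real.sqrt 2 : ℂ)⁻¹ * ρ := by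
    rw [SL2_inv_zero_zero]; simp [cayley, hρ]
  have e01 : (cayley D hD)⁻¹ 0 1 = -((Real.sqrt 2 : ℂ)⁻¹ * (Complex.I * ρ)) := by
    rw [SL2_inv_zero_one]; simp [cayley, hρ]
  have e10 : (cayley D hD)⁻¹ 1 0 = -((Real.sqrt 2 : ℂ)⁻¹ * (Complex.I * (ρ : ℂ)⁻¹)) := by
    rw [SL2_inv_one_zero]; simp [cayley, hρ]
  have e11 : (cayley D hD)⁻¹ 1 1 = (Real.sqrt 2 : ℂ)⁻¹ * (ρ : ℂ)⁻¹ := by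
    rw [SL2_inv_one_one]; simp [cayley, hρ]
  induction p using OnePoint.rec with
  | infty =>
    rw [P_smul_infty, e00, e10, if_neg (by simp [h2, hρc]), sideFun_coe]
    have : (Real.sqrt 2 : ℂ)⁻¹ * ρ / -((Real.sqrt 2 : ℂ)⁻¹ * (Complex.I * (ρ : ℂ)⁻¹)) =
        Complex.I * (ρ : ℂ) ^ 2 := by
      field_simp
      rw [Complex.I_sq]
    rw [this, map_mul, map_pow, Complex.normSq_I, Complex.normSq_ofReal, ← hρ4]
    simp only [realCircle, Set.mem_insert_iff, true_or, iff_true]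
    ring
  | coe z =>
    have hz : ((z : ℂ) : OnePoint ℂ) ∈ realCircle ↔ z.im = 0 := by
      simp only [realCircle, Set.mem_insert_iff, OnePoint.coe_ne_infty, Set.mem_range, false_or,
        OnePoint.coe_eq_coe]
      constructor
      · rintro ⟨t, rfl⟩; simp
      · intro h; exact ⟨z.re, Complex.ext rfl h.symm⟩
    rw [hz, P_smul_coe, e00, e01, e10, e11]
    have hden : -((Real.sqrt 2 : ℂ)⁻¹ * (Complex.I * (ρ : ℂ)⁻¹)) * z +
        (Real.sqrt 2 : ℂ)⁻¹ * (ρ : ℂ)⁻¹ =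
        (Real.sqrt 2 : ℂ)⁻¹ * (ρ : ℂ)⁻¹ * (1 - Complex.I * z) := by ring
    have hnum : (Real.sqrt 2 : ℂ)⁻¹ * ρ * z + -((Real.sqrt 2 : ℂ)⁻¹ * (Complex.I * ρ)) =
        (Real.sqrt 2 : ℂ)⁻¹ * (ρ : ℂ) * (z - Complex.I) := by ring
    rw [hden, hnum]
    split_ifs with h
    · simp only [mul_eq_zero, inv_eq_zero, h2, hρc, false_or] at h
      have him := congrArg Complex.re h
      simp at him
      rw [sideFun_infty]
      constructor
      · intro h; norm_num at h
      · intro h; rw [h] at him; norm_num at him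
    · rw [sideFun_coe]
      simp only [mul_eq_zero, inv_eq_zero, h2, hρc, false_or] at h
      have hpos := Complex.normSq_pos.2 h
      have : (Real.sqrt 2 : ℂ)⁻¹ * (ρ : ℂ) * (z - Complex.I) /
          ((Real.sqrt 2 : ℂ)⁻¹ * (ρ : ℂ)⁻¹ * (1 - Complex.I * z)) =
          (ρ : ℂ) ^ 2 * (z - Complex.I) / (1 - Complex.I * z) := by
        field_simp
      rw [this, map_div₀, map_mul, map_pow, Complex.normSq_ofReal,
        show (ρ * ρ) ^ 2 = (D : ℝ) by rw [← hρ4]; ring, sub_eq_zero, div_eq_iff hpos.ne',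
        mul_right_inj' (by positivity)]
      simp only [Complex.normSq_apply]
      simp
      constructor <;> intro h <;> nlinarith

/-- The real matrix conjugate under `cayley` to the matrix with rows `(A, D B̄)`, `(B, Ā)`. -/
def realForm (D : ℕ) (A B : ℂ) (h : Complex.normSq A - D * Complex.normSq B = 1) : SL(2, ℝ) :=
  ⟨!![A.re - Real.sqrt D * B.im, A.im + Real.sqrt D * B.re;
      -A.im + Real.sqrt D * B.re, A.re + Real.sqrt D * B.im], by
    have hs : Real.sqrt D * Real.sqrt D = D := Real.mul_self_sqrt (Nat.cast_nonneg D)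
    rw [Matrix.det_fin_two_of, ← h, Complex.normSq_apply, Complex.normSq_apply]
    linear_combination (-(B.re * B.re + B.im * B.im)) * hs⟩

lemma realForm_mem_realModel {d D : ℕ} (hD : 0 < D) (a c : ℤ√(-d : ℤ))
    (h : a.norm - D * c.norm = 1)
    (h' : Complex.normSq (zc d a) - D * Complex.normSq (zc d c) = 1) :
    realForm D (zc d a) (zc d c) h' ∈
      realModel ((bianchiStab d (circleOf D)).map (incl d)) (P ℂ (cayley D hD)) := by
  have hmem := Subgroup.mem_map_of_mem (incl d) (orderUnit_mem_bianchiStab a c h)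
  rw [realModel, Subgroup.mem_comap]
  convert hmem using 1
  simp only [MonoidHom.comp_apply, MulEquiv.coe_toMonoidHom, MulAut.conj_apply, inv_inv]
  rw [incl_P, mul_assoc, inv_mul_eq_iff_eq_mul, ← map_mul, ← map_mul]
  congr 1
  have hss : (Real.sqrt (Real.sqrt D) : ℂ) ^ 2 = Real.sqrt D := by
    exact_mod_cast Real.sq_sqrt (Real.sqrt_nonneg D)
  have hss' : (Real.sqrt D : ℂ) ^ 2 = D := by
    exact_mod_cast Real.sq_sqrt (Nat.cast_nonneg D)
  have hr0 : (Real.sqrt (Real.sqrt D) : ℂ) ≠ 0 := by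
    exact_mod_cast (Real.sqrt_pos.2 (Real.sqrt_pos.2 (by exact_mod_cast hD))).ne'
  set s := Matrix.SpecialLinearGroup.map Complex.ofRealHom (realForm D (zc d a) (zc d c) h')
  set m := Matrix.SpecialLinearGroup.map (algebraMap (ringOfInt d) ℂ) (orderUnit a c h)
  have hre : ∀ z : ℂ, z = z.re + z.im * Complex.I := fun z => (Complex.re_add_im z).symm
  have him : ∀ z : ℂ, conj z = z.re - z.im * Complex.I := fun z => by
    apply Complex.ext <;> simp
  have m00 : m 0 0 = (zc d a).re + (zc d a).im * Complex.I := hre _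
  have m01 : m 0 1 = D * ((zc d c).re - (zc d c).im * Complex.I) := by
    rw [← him, ← zc_star, ← map_natCast (algebraMap (ringOfInt d) ℂ) D]
    exact map_mul (algebraMap (ringOfInt d) ℂ) _ _
  have m10 : m 1 0 = (zc d c).re + (zc d c).im * Complex.I := hre _
  have m11 : m 1 1 = (zc d a).re - (zc d a).im * Complex.I := by
    rw [← him, ← zc_star]
    rfl
  have s00 : s 0 0 = ((zc d a).re - Real.sqrt D * (zc d c).im : ℝ) := rfl
  have s01 : s 0 1 = ((zc d a).im + Real.sqrt D * (zc d c).re : ℝ) := rfl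
  have s10 : s 1 0 = (-(zc d a).im + Real.sqrt D * (zc d c).re : ℝ) := rfl
  have s11 : s 1 1 = ((zc d a).re + Real.sqrt D * (zc d c).im : ℝ) := rfl
  push_cast at s00 s01 s10 s11
  rw [← hss', ← hss] at m01
  rw [← hss] at s00 s01 s10 s11
  ext i j
  rw [Matrix.SpecialLinearGroup.coe_mul, Matrix.SpecialLinearGroup.coe_mul, Matrix.mul_apply,
    Matrix.mul_apply, Fin.sum_univ_two, Fin.sum_univ_two]
  fin_cases i <;> fin_cases j <;>
    simp only [Fin.zero_eta, Fin.mk_one, s00, s01, s10, s11, m00, m01, m10, m11, cayley,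
      Matrix.smul_apply, Matrix.of_apply, Matrix.cons_val', Matrix.cons_val_zero,
      Matrix.cons_val_one, Matrix.cons_val_fin_one, smul_eq_mul] <;>
    generalize (Real.sqrt (Real.sqrt D) : ℂ) = ρ at hr0 <;>
    field_simp <;>
    ring_nf <;>
    simp only [Complex.I_sq] <;>
    ring

/-- The points `x • i` with `x` in a compact subset of `SL₂(ℝ)` represent all orbits, by
`exists_bounded_representative`. -/
lemma compactSpace_quotient {d D : ℕ} (hd : d.Prime) (hD0 : 0 < D)
    (hD : ¬ IsSquare (D : ZMod d)) :
    CompactSpace (Quotient (MulAction.orbitRel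
      (realModel ((bianchiStab d (circleOf D)).map (incl d)) (P ℂ (cayley D hD0))) ℍ)) := by
  obtain ⟨M, hM⟩ := exists_bounded_representative hd hD
  let S : Set SL(2, ℝ) := {x | ∀ i j, x i j ∈ Set.Icc (-(4 * M + 1)) (4 * M + 1)}
  have hS : IsCompact S := by
    have h1 : IsCompact (Set.univ.pi fun _ : Fin 2 => Set.univ.pi fun _ : Fin 2 =>
        Set.Icc (-(4 * M + 1)) (4 * M + 1)) :=
      isCompact_univ_pi fun _ => isCompact_univ_pi fun _ => isCompact_Icc
    have h2 := (Matrix.SpecialLinearGroup.isClosedEmbedding_val (n := Fin 2)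
      (R := ℝ)).isCompact_preimage h1
    have h3 : S = (fun x : SL(2, ℝ) => (x : Matrix (Fin 2) (Fin 2) ℝ)) ⁻¹'
        (Set.univ.pi fun _ : Fin 2 => Set.univ.pi fun _ : Fin 2 =>
          Set.Icc (-(4 * M + 1)) (4 * M + 1)) := by
      ext x
      exact ⟨fun h i _ j _ => h i j, fun h i j => h i trivial j trivial⟩
    rw [h3]
    exact h2
  have hK : IsCompact ((fun x : SL(2, ℝ) => x • UpperHalfPlane.I) '' S) :=
    hS.image (by fun_prop)
  refine ⟨?_⟩
  convert hK.image continuous_quotient_mk' using 1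
  symm
  rw [Set.eq_univ_iff_forall]
  intro q
  induction q using Quotient.inductionOn with
  | h τ =>
  obtain ⟨x, hx⟩ := MulAction.exists_smul_eq SL(2, ℝ) UpperHalfPlane.I τ
  have hr : 0 < Real.sqrt D := Real.sqrt_pos.2 (by exact_mod_cast hD0)
  have hs : Real.sqrt D * Real.sqrt D = D := Real.mul_self_sqrt (Nat.cast_nonneg D)
  have hdet := x.det_coe
  rw [Matrix.det_fin_two] at hdet
  -- `x` is `realForm D A B` for the following `A` and `B`
  let A : ℂ := ⟨(x 0 0 + x 1 1) / 2, (x 0 1 - x 1 0) / 2⟩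
  let B : ℂ := ⟨(x 0 1 + x 1 0) / (2 * Real.sqrt D), (x 1 1 - x 0 0) / (2 * Real.sqrt D)⟩
  have hAB : Complex.normSq A - D * Complex.normSq B = 1 := by
    simp only [A, B, Complex.normSq_apply]
    field_simp
    linear_combination (4 * Real.sqrt D ^ 2) * hdet +
      ((x 0 1 + x 1 0) ^ 2 + (x 1 1 - x 0 0) ^ 2) * hs
  obtain ⟨a, c, hac, hb⟩ := hM A B hAB
  have hac' : Complex.normSq (zc d a) - D * Complex.normSq (zc d c) = 1 := by
    rw [normSq_zc, normSq_zc]; exact_mod_cast hac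
  set s := realForm D (zc d a) (zc d c) hac' with hsdef
  refine ⟨s⁻¹ • τ, ⟨s⁻¹ * x, ?_, by rw [← hx, ← mul_smul]⟩, ?_⟩
  · set y := s⁻¹ * x with hy
    have hdy := y.det_coe
    rw [Matrix.det_fin_two] at hdy
    have hbound : (y 0 0 + y 1 1) ^ 2 + (y 0 1 - y 1 0) ^ 2 ≤ 4 * M := by
      refine le_trans (le_of_eq ?_) (mul_le_mul_of_nonneg_left hb (by norm_num))
      have y00 : y 0 0 = s 1 1 * x 0 0 - s 0 1 * x 1 0 := by
        rw [hy, Matrix.SpecialLinearGroup.coe_mul, Matrix.mul_apply, Fin.sum_univ_two,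
          SL2_inv_zero_zero, SL2_inv_zero_one]; ring
      have y01 : y 0 1 = s 1 1 * x 0 1 - s 0 1 * x 1 1 := by
        rw [hy, Matrix.SpecialLinearGroup.coe_mul, Matrix.mul_apply, Fin.sum_univ_two,
          SL2_inv_zero_zero, SL2_inv_zero_one]; ring
      have y10 : y 1 0 = -s 1 0 * x 0 0 + s 0 0 * x 1 0 := by
        rw [hy, Matrix.SpecialLinearGroup.coe_mul, Matrix.mul_apply, Fin.sum_univ_two,
          SL2_inv_one_zero, SL2_inv_one_one]
      have y11 : y 1 1 = -s 1 0 * x 0 1 + s 0 0 * x 1 1 := by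
        rw [hy, Matrix.SpecialLinearGroup.coe_mul, Matrix.mul_apply, Fin.sum_univ_two,
          SL2_inv_one_zero, SL2_inv_one_one]
      rw [y00, y01, y10, y11]
      have x00 : x 0 0 = A.re - Real.sqrt D * B.im := by simp [A, B]; field_simp; ring
      have x11 : x 1 1 = A.re + Real.sqrt D * B.im := by simp [A, B]; field_simp; ring
      have x01 : x 0 1 = A.im + Real.sqrt D * B.re := by simp [A, B]; field_simp; ring
      have x10 : x 1 0 = -A.im + Real.sqrt D * B.re := by simp [A, B]; field_simp; ring
      rw [x00, x01, x10, x11]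
      simp only [hsdef, realForm, Complex.normSq_apply]
      clear_value A B
      simp
      generalize Real.sqrt D = r at hs ⊢
      rw [← hs]
      ring
    have h1 : (y 0 0) ^ 2 + (y 0 1) ^ 2 + (y 1 0) ^ 2 + (y 1 1) ^ 2 ≤ 4 * M := by
      linarith
    intro i j
    have h2 : (y i j) ^ 2 ≤ 4 * M := by
      fin_cases i <;> fin_cases j <;> simp <;>
        nlinarith [sq_nonneg (y 0 0), sq_nonneg (y 0 1), sq_nonneg (y 1 0), sq_nonneg (y 1 1)]
    constructor <;> nlinarith [sq_nonneg (y i j - 1), sq_nonneg (y i j + 1)]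
  · apply Quotient.sound
    exact ⟨⟨s⁻¹, inv_mem (realForm_mem_realModel hD0 a c hac hac')⟩, rfl⟩

lemma isCocompactFuchsian_bianchiStab {d D : ℕ} (hd : d.Prime) (hD0 : 0 < D)
    (hD : ¬ IsSquare (D : ZMod d)) :
    IsCocompactFuchsian ((bianchiStab d (circleOf D)).map (incl d)) := by
  refine ⟨discreteTopology_map_incl _, circleOf D,
    Or.inl ⟨0, Real.sqrt D, Real.sqrt_pos.2 (by exact_mod_cast hD0), rfl⟩, ?_,
    P ℂ (cayley D hD0), cayley_smul_circleOf D hD0, compactSpace_quotient hd hD0 hD⟩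
  exact Subgroup.map_comap_le _ _

/-! ### Non-commensurability -/

/-- The matrix of the Hermitian form `|z|² - D|w|²`. -/
def circleForm (D : ℕ) : Matrix (Fin 2) (Fin 2) ℂ := !![1, 0; 0, -(D : ℂ)]

lemma det_circleForm (D : ℕ) : (circleForm D).det = -(D : ℂ) := by
  simp [circleForm, Matrix.det_fin_two_of]

/-- The image of an element of `SL₂(O_d)` in the complex `2 × 2` matrices. -/
abbrev toMat {d : ℕ} (A : SL(2, ringOfInt d)) : Matrix (Fin 2) (Fin 2) ℂ :=
  (Matrix.SpecialLinearGroup.map (algebraMap (ringOfInt d) ℂ) A : SL(2, ℂ))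

lemma toMat_mul {d : ℕ} (A B : SL(2, ringOfInt d)) : toMat (A * B) = toMat A * toMat B := by
  simp only [toMat, map_mul, Matrix.SpecialLinearGroup.coe_mul]

lemma toMat_one {d : ℕ} : toMat (1 : SL(2, ringOfInt d)) = 1 := by
  simp only [toMat, map_one, Matrix.SpecialLinearGroup.coe_one]

lemma toMat_pow {d : ℕ} (A : SL(2, ringOfInt d)) (n : ℕ) : toMat (A ^ n) = toMat A ^ n := by
  simp only [toMat, map_pow, Matrix.SpecialLinearGroup.coe_pow]

lemma det_toMat {d : ℕ} (A : SL(2, ringOfInt d)) : (toMat A).det = 1 :=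
  Matrix.SpecialLinearGroup.det_coe _

/-- The elements of `Stab(C_D)` preserve the form up to a sign. -/
lemma circleForm_of_mem {d D : ℕ} (hD : 0 < D) (T : SL(2, ringOfInt d))
    (hT : P _ T ∈ bianchiStab d (circleOf D)) :
    ∃ l : ℂ, l ^ 2 = 1 ∧ (toMat T).conjTranspose * circleForm D * toMat T = l • circleForm D := by
  rw [bianchiStab, Subgroup.mem_comap, incl_P] at hT
  obtain ⟨h1, h2⟩ := form_of_mem_circleStab hD _ hT
  have h3 := congrArg conj h1
  simp only [map_mul, Complex.conj_conj, map_natCast] at h3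
  have h4 : toMat T 0 1 * conj (toMat T 0 1) - D * (toMat T 1 1 * conj (toMat T 1 1)) =
      -D * (toMat T 0 0 * conj (toMat T 0 0) - D * (toMat T 1 0 * conj (toMat T 1 0))) := by
    simp only [Complex.mul_conj]
    exact_mod_cast h2
  have key : (toMat T).conjTranspose * circleForm D * toMat T =
      (toMat T 0 0 * conj (toMat T 0 0) - D * (toMat T 1 0 * conj (toMat T 1 0))) •
        circleForm D := by
    have e01 : conj (toMat T 0 0) * toMat T 0 1 - D * (conj (toMat T 1 0) * toMat T 1 1) = 0 := by
      linear_combination h3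
    have e10 : conj (toMat T 0 1) * toMat T 0 0 - D * (conj (toMat T 1 1) * toMat T 1 0) = 0 := by
      linear_combination h1
    generalize toMat T = t at *
    ext i j
    fin_cases i <;> fin_cases j <;>
      simp [Matrix.mul_apply, Fin.sum_univ_two, circleForm, Matrix.conjTranspose_apply]
    · ring
    · linear_combination e01
    · linear_combination e10
    · linear_combination h4
  refine ⟨_, ?_, key⟩
  have hdet := congrArg Matrix.det key
  rw [Matrix.det_mul, Matrix.det_mul, Matrix.det_conjTranspose, det_toMat, Matrix.det_smul,
    det_circleForm] at hdet
  have hD' : (D : ℂ) ≠ 0 := by exact_mod_cast hD.ne'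
  simp only [star_one, one_mul, mul_one, Fintype.card_fin] at hdet
  apply mul_right_cancel₀ (neg_ne_zero.2 hD')
  rw [← hdet, one_mul]

lemma circleForm_sq_of_mem {d D : ℕ} (hD : 0 < D) (T : SL(2, ringOfInt d))
    (hT : P _ T ∈ bianchiStab d (circleOf D)) :
    (toMat (T ^ 2)).conjTranspose * circleForm D * toMat (T ^ 2) = circleForm D := by
  obtain ⟨l, hl, h⟩ := circleForm_of_mem hD T hT
  rw [toMat_pow, pow_two, Matrix.conjTranspose_mul]
  calc _ = (toMat T).conjTranspose * ((toMat T).conjTranspose * circleForm D * toMat T) *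
        toMat T := by simp only [Matrix.mul_assoc]
    _ = (l ^ 2) • circleForm D := by
        rw [h, Matrix.mul_smul, Matrix.smul_mul, h, smul_smul, pow_two]
    _ = _ := by rw [hl, one_smul]

/-- Powers of a solution of Pell's equation, with `X` in the role of `√e`. -/
lemma exists_pell_pow {X : Matrix (Fin 2) (Fin 2) ℂ} {e p c : ℕ} (hX : X * X = (e : ℂ) • 1)
    (hp : 0 < p) (hc : 0 < c) (h : p ^ 2 = e * c ^ 2 + 1) (k : ℕ) :
    ∃ p' c' : ℕ, 0 < p' ∧ 0 < c' ∧ p' ^ 2 = e * c' ^ 2 + 1 ∧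
      ((p : ℂ) • 1 + (c : ℂ) • X) ^ (k + 1) = (p' : ℂ) • 1 + (c' : ℂ) • X := by
  induction k with
  | zero => exact ⟨p, c, hp, hc, h, pow_one _⟩
  | succ k ih =>
    obtain ⟨p', c', hp', hc', h', hk⟩ := ih
    refine ⟨p' * p + e * c' * c, p' * c + c' * p, by positivity, by positivity, ?_, ?_⟩
    · zify at h h' ⊢
      linear_combination (p ^ 2 - e * c ^ 2 : ℤ) * h' + h
    · rw [pow_succ, hk]
      simp only [add_mul, mul_add, Matrix.smul_mul, Matrix.mul_smul, hX, Matrix.one_mul,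
        Matrix.mul_one, smul_smul]
      push_cast
      module

/-- If `p + c X`, with inverse `p - c X`, preserves the form `h`, then `X` is skew with respect
to `h`. The conclusion does not depend on `p` and `c`, so it can be drawn from any power. -/
lemma skew_of_preserves {X h : Matrix (Fin 2) (Fin 2) ℂ} {e p c : ℕ} (hX : X * X = (e : ℂ) • 1)
    (hc : 0 < c) (hpc : p ^ 2 = e * c ^ 2 + 1)
    (hU : ((p : ℂ) • 1 + (c : ℂ) • X).conjTranspose * h * ((p : ℂ) • 1 + (c : ℂ) • X) = h) :
    X.conjTranspose * h + h * X = 0 := by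
  have hUV : ((p : ℂ) • (1 : Matrix (Fin 2) (Fin 2) ℂ) + (c : ℂ) • X) *
      ((p : ℂ) • 1 - (c : ℂ) • X) = 1 := by
    have hpc' : (p : ℂ) ^ 2 = e * c ^ 2 + 1 := by exact_mod_cast hpc
    simp only [add_mul, mul_sub, Matrix.smul_mul, Matrix.mul_smul, hX, Matrix.one_mul,
      Matrix.mul_one, smul_smul]
    calc _ = ((p : ℂ) ^ 2 - e * c ^ 2) • (1 : Matrix (Fin 2) (Fin 2) ℂ) := by module
      _ = 1 := by rw [hpc', add_sub_cancel_left, one_smul]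
  have h1 : ((p : ℂ) • 1 + (c : ℂ) • X).conjTranspose * h = h * ((p : ℂ) • 1 - (c : ℂ) • X) := by
    conv_rhs => rw [← hU, Matrix.mul_assoc _ _ (_ - _), hUV, Matrix.mul_one]
  rw [Matrix.conjTranspose_add, Matrix.conjTranspose_smul, Matrix.conjTranspose_smul,
    Matrix.conjTranspose_one] at h1
  simp only [add_mul, mul_sub, Matrix.smul_mul, Matrix.mul_smul, Matrix.one_mul,
      Matrix.mul_one, star_natCast] at h1
  have hc0 : (c : ℂ) ≠ 0 := by exact_mod_cast hc.ne'
  have h2 : (c : ℂ) • (X.conjTranspose * h + h * X) = 0 := by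
    rw [smul_add]
    have := sub_eq_zero.2 h1
    rw [← this]
    module
  exact (smul_eq_zero.1 h2).resolve_left hc0

/-- If `G Stab(C_D') G⁻¹` meets `Stab(C_D)` in a subgroup of finite index, then for every
`p + c X` in `Stab(C_D)` the matrix `X` is skew with respect to the form of the circle `G C_D'`. -/
lemma skew_of_relIndex_ne_zero {d D D' : ℕ} (hD' : 0 < D') (G : SL(2, ringOfInt d))
    (hidx : ((bianchiStab d (circleOf D')).map (MulAut.conj (P _ G)).toMonoidHom).relIndex
      (bianchiStab d (circleOf D)) ≠ 0)
    (A : SL(2, ringOfInt d)) (hA : P _ A ∈ bianchiStab d (circleOf D))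
    {X : Matrix (Fin 2) (Fin 2) ℂ} {e p c : ℕ} (hX : X * X = (e : ℂ) • 1)
    (hp : 0 < p) (hc : 0 < c) (hpc : p ^ 2 = e * c ^ 2 + 1)
    (hAX : toMat A = (p : ℂ) • 1 + (c : ℂ) • X) :
    X.conjTranspose * ((toMat G⁻¹).conjTranspose * circleForm D' * toMat G⁻¹) +
      ((toMat G⁻¹).conjTranspose * circleForm D' * toMat G⁻¹) * X = 0 := by
  obtain ⟨n, hn, -, hmem⟩ := Subgroup.exists_pow_mem_of_relIndex_ne_zero hidx hA
  obtain ⟨y, hy, hyn⟩ := (Subgroup.mem_inf.1 hmem).1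
  have hT : P _ (G⁻¹ * A ^ n * G) ∈ bianchiStab d (circleOf D') := by
    convert hy using 1
    rw [map_mul, map_mul, map_inv, map_pow, ← hyn]
    simp [mul_assoc]
  have h1 := circleForm_sq_of_mem hD' _ hT
  have h2 : (G⁻¹ * A ^ n * G) ^ 2 = G⁻¹ * A ^ (n * 2) * G := by
    rw [mul_two, pow_add, pow_two]; group
  obtain ⟨p', c', -, hc', hpc', hk⟩ := exists_pell_pow hX hp hc hpc (n * 2 - 1)
  rw [Nat.sub_add_cancel (by omega), ← hAX, ← toMat_pow] at hk
  refine skew_of_preserves hX hc' hpc' ?_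
  rw [← hk]
  have h3 : toMat G * toMat G⁻¹ = 1 := by rw [← toMat_mul, mul_inv_cancel, toMat_one]
  rw [h2, toMat_mul, toMat_mul] at h1
  simp only [Matrix.conjTranspose_mul] at h1
  have h4 : (toMat G⁻¹).conjTranspose * (toMat G).conjTranspose = 1 := by
    rw [← Matrix.conjTranspose_mul, h3, Matrix.conjTranspose_one]
  calc _ = ((toMat G⁻¹).conjTranspose * (toMat G).conjTranspose) *
        (toMat (A ^ (n * 2))).conjTranspose * (toMat G⁻¹).conjTranspose * circleForm D' *
        toMat G⁻¹ * toMat (A ^ (n * 2)) * (toMat G * toMat G⁻¹) := by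
        rw [h3, h4]; simp only [Matrix.mul_assoc, Matrix.one_mul, Matrix.mul_one]
    _ = (toMat G⁻¹).conjTranspose * ((toMat G).conjTranspose *
        ((toMat (A ^ (n * 2))).conjTranspose * (toMat G⁻¹).conjTranspose) * circleForm D' *
        (toMat G⁻¹ * toMat (A ^ (n * 2)) * toMat G)) * toMat G⁻¹ := by
        simp only [Matrix.mul_assoc]
    _ = _ := by rw [h1]

lemma exists_pell {e : ℕ} (he : 0 < e) (hsq : ¬ IsSquare e) :
    ∃ p c : ℕ, 0 < p ∧ 0 < c ∧ p ^ 2 = e * c ^ 2 + 1 := by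
  obtain ⟨x, y, h, hy⟩ := Pell.exists_of_not_isSquare (d := (e : ℤ)) (by exact_mod_cast he)
    (by rwa [Int.isSquare_natCast_iff])
  refine ⟨x.natAbs, y.natAbs, ?_, Int.natAbs_pos.2 hy, ?_⟩
  · rw [Int.natAbs_pos]
    rintro rfl
    have : (0 : ℤ) < e := by exact_mod_cast he
    nlinarith [sq_nonneg y]
  · zify
    rw [sq_abs, sq_abs]
    linarith

/-- The upper left entry of an `SL₂(O_d)`-translate of the form is `|a|² - D |c|²` with
`a, c ∈ O_d`. -/
lemma exists_int_entry {d : ℕ} (A : SL(2, ringOfInt d)) (D : ℕ) :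
    ∃ m : ℤ, ((toMat A).conjTranspose * circleForm D * toMat A) 0 0 = m := by
  obtain ⟨x, hx⟩ := exists_normSq_eq d (A 0 0)
  obtain ⟨y, hy⟩ := exists_normSq_eq d (A 1 0)
  refine ⟨x - D * y, ?_⟩
  have hx' : conj (toMat A 0 0) * toMat A 0 0 = x := by
    rw [mul_comm, Complex.mul_conj]; exact_mod_cast hx
  have hy' : conj (toMat A 1 0) * toMat A 1 0 = y := by
    rw [mul_comm, Complex.mul_conj]; exact_mod_cast hy
  generalize toMat A = t at *
  simp [Matrix.mul_apply, Fin.sum_univ_two, circleForm, Matrix.conjTranspose_apply]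
  linear_combination hx' - D * hy'

/-- The forms of `G C_D'` and `C_D` are shown to be proportional. The factor
and its inverse are entries of translates of the forms by `G⁻¹` and `G`, hence integers, so the
factor is `±1`, and comparing determinants gives `D' = D`. -/
lemma not_commensurableIn {d D D' : ℕ} (hd : d.Prime) (hD : ¬ IsSquare (D : ZMod d))
    (hD' : 0 < D') (hne : D' ≠ D) :
    ¬ CommensurableIn (bianchiStab d (circleOf D')) (bianchiStab d (circleOf D)) := by
  have := Fact.mk hd
  rintro ⟨g, hg, -⟩
  obtain ⟨G, rfl⟩ := QuotientGroup.mk_surjective g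
  have hD0 : 0 < D := Nat.pos_of_ne_zero (by rintro rfl; simp at hD)
  have hdD : ¬ d ∣ D := by
    intro h
    rw [(ZMod.natCast_eq_zero_iff D d).2 h] at hD
    simp at hD
  have hs1 : ¬ IsSquare D := fun h => hD (h.map (Nat.castRingHom (ZMod d)))
  have hs2 : ¬ IsSquare (d * D) := by
    rintro ⟨r, hr⟩
    have h1 : d ∣ r * r := hr ▸ dvd_mul_right d D
    obtain ⟨s, rfl⟩ := (hd.dvd_mul.1 h1).elim id id
    apply hdD
    refine ⟨s * s, Nat.eq_of_mul_eq_mul_left hd.pos ?_⟩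
    rw [hr]; ring
  obtain ⟨p, c, hp, hc, hpc⟩ := exists_pell hD0 hs1
  obtain ⟨q, b, hq, hb, hqb⟩ := exists_pell (Nat.mul_pos hd.pos hD0) hs2
  set δ : ℂ := Complex.I * (Real.sqrt d : ℂ) with hδ
  have hδ2 : δ ^ 2 = -(d : ℂ) := I_sqrt_sq d
  have hδc : conj δ = -δ := by simp [hδ]
  have hδ0 : δ ≠ 0 := by
    intro h
    rw [h] at hδ2
    have : (d : ℂ) = 0 := by linear_combination hδ2
    exact hd.ne_zero (by exact_mod_cast this)
  have hmat : ∀ (a c : ℤ√(-d : ℤ)) (h : a.norm - D * c.norm = 1),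
      toMat (orderUnit a c h) = !![zc d a, D * conj (zc d c); zc d c, conj (zc d a)] := by
    intro a c h
    rw [← zc_star, ← zc_star]
    ext i j
    fin_cases i <;> fin_cases j
    · rfl
    · change algebraMap (ringOfInt d) ℂ (D * ofZsqrtd d (star c)) = D * zc d (star c)
      rw [map_mul, map_natCast]
      rfl
    · rfl
    · rfl
  -- the form of `G C_D'`; Pell's equations for `D` and `d D` give two elements of `Stab(C_D)`
  set h := (toMat G⁻¹).conjTranspose * circleForm D' * toMat G⁻¹ with hh
  have k1 : (!![0, (D : ℂ); 1, 0]).conjTranspose * h + h * !![0, (D : ℂ); 1, 0] = 0 := by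
    have hn : (⟨p, 0⟩ : ℤ√(-d : ℤ)).norm - D * (⟨c, 0⟩ : ℤ√(-d : ℤ)).norm = 1 := by
      rw [norm_coe_eq, norm_coe_eq]
      have : (p : ℤ) ^ 2 = D * c ^ 2 + 1 := by exact_mod_cast hpc
      simp; linarith
    refine skew_of_relIndex_ne_zero hD' G hg _ (orderUnit_mem_bianchiStab _ _ hn) (e := D)
      (p := p) (c := c) ?_ hp hc hpc ?_
    · ext i j
      fin_cases i <;> fin_cases j <;> simp [Matrix.mul_apply, Fin.sum_univ_two]
    · rw [hmat, zc_apply, zc_apply]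
      ext i j
      fin_cases i <;> fin_cases j <;> simp [mul_comm]
  have k2 : (!![0, -(D : ℂ) * δ; δ, 0]).conjTranspose * h + h * !![0, -(D : ℂ) * δ; δ, 0] = 0 := by
    have hn : (⟨q, 0⟩ : ℤ√(-d : ℤ)).norm - D * (⟨0, b⟩ : ℤ√(-d : ℤ)).norm = 1 := by
      rw [norm_coe_eq, norm_coe_eq]
      have : (q : ℤ) ^ 2 = d * D * b ^ 2 + 1 := by exact_mod_cast hqb
      simp; linarith
    refine skew_of_relIndex_ne_zero hD' G hg _ (orderUnit_mem_bianchiStab _ _ hn) (e := d * D)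
      (p := q) (c := b) ?_ hq hb hqb ?_
    · ext i j
      fin_cases i <;> fin_cases j <;> simp [Matrix.mul_apply, Fin.sum_univ_two]
      all_goals linear_combination (-D : ℂ) * hδ2
    · rw [hmat, zc_apply, zc_apply]
      simp only [← hδ]
      ext i j
      fin_cases i <;> fin_cases j <;> simp [hδc]
      ring
  -- the two relations leave only the multiples of the form of `C_D`
  have hform : h = h 0 0 • circleForm D := by
    have a00 := congrFun (congrFun k1 0) 0
    have a01 := congrFun (congrFun k1 0) 1
    have b00 := congrFun (congrFun k2 0) 0
    simp [Matrix.mul_apply, Fin.sum_univ_two, Matrix.conjTranspose_apply] at a00 a01 b00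
    rw [hδc] at b00
    have h01 : h 0 1 = 0 := by
      apply mul_left_cancel₀ hδ0
      linear_combination b00 / 2 + δ * a00 / 2
    have h10 : h 1 0 = 0 := by linear_combination a00 - h01
    ext i j
    fin_cases i <;> fin_cases j <;> simp [circleForm, h01, h10]
    linear_combination a01
  obtain ⟨m, hm⟩ := exists_int_entry G⁻¹ D'
  obtain ⟨m', hm'⟩ := exists_int_entry G D
  rw [← hh] at hm
  rw [hm] at hform
  have hdet : D' = m ^ 2 * D := by
    have := congrArg Matrix.det hform
    rw [hh, Matrix.det_mul, Matrix.det_mul, Matrix.det_conjTranspose, det_toMat, Matrix.det_smul,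
      det_circleForm, det_circleForm] at this
    simp at this
    exact_mod_cast this
  have hmm : m * m' = 1 := by
    have h3 : toMat G⁻¹ * toMat G = 1 := by rw [← toMat_mul, inv_mul_cancel, toMat_one]
    have h4 : (toMat G).conjTranspose * (toMat G⁻¹).conjTranspose = 1 := by
      rw [← Matrix.conjTranspose_mul, h3, Matrix.conjTranspose_one]
    have h5 : (toMat G).conjTranspose * h * toMat G = circleForm D' := by
      calc _ = ((toMat G).conjTranspose * (toMat G⁻¹).conjTranspose) * circleForm D' *
            (toMat G⁻¹ * toMat G) := by rw [hh]; simp only [Matrix.mul_assoc]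
        _ = _ := by rw [h3, h4, Matrix.one_mul, Matrix.mul_one]
    rw [hform, Matrix.mul_smul, Matrix.smul_mul] at h5
    have h6 := congrFun (congrFun h5 0) 0
    rw [Matrix.smul_apply, hm'] at h6
    simp [circleForm] at h6
    exact_mod_cast h6
  apply hne
  have : m ^ 2 = 1 := by
    rcases Int.eq_one_or_neg_one_of_mul_eq_one hmm with rfl | rfl <;> rfl
  rw [this, one_mul] at hdet
  exact_mod_cast hdet

/-! ### Elements of the normal closure -/

lemma unipotent_add {R : Type*} [CommRing R] (x y : R) :
    unipotent (x + y) = unipotent x * unipotent y := by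
  apply Subtype.ext
  rw [Matrix.SpecialLinearGroup.coe_mul]
  simp [unipotent, add_comm]

lemma unipotent_zsmul {R : Type*} [CommRing R] (x : R) (n : ℤ) :
    unipotent (n • x) = unipotent x ^ n := by
  let f : Multiplicative R →* SL(2, R) :=
    MonoidHom.mk' (fun r => unipotent r.toAdd) fun a b => unipotent_add _ _
  exact map_zpow f (Multiplicative.ofAdd x) n

lemma unipotent_mul_conj_mem {R : Type*} [CommRing R] {K : Subgroup (PSL2 R)} [K.Normal] {ξ : R}
    (h : P R (unipotent ξ) ∈ K) (m n : ℤ) (γ : SL(2, R)) :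
    P R (unipotent (m * ξ) * (γ * unipotent (n * ξ) * γ⁻¹)) ∈ K := by
  have hσ : ∀ n : ℤ, P R (unipotent (n * ξ)) ∈ K := by
    intro n
    rw [← zsmul_eq_mul, unipotent_zsmul, map_zpow]
    exact zpow_mem h n
  rw [map_mul, map_mul, map_mul, map_inv]
  exact mul_mem (hσ m) (Subgroup.Normal.conj_mem inferInstance _ (hσ n) _)

lemma coe_unipotent_mul_conj {R : Type*} [CommRing R] (a b : R) (γ : SL(2, R)) :
    (unipotent a * (γ * unipotent b * γ⁻¹) : Matrix (Fin 2) (Fin 2) R) =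
      !![1 - b * γ 0 0 * γ 1 0 - a * b * γ 1 0 ^ 2,
        b * γ 0 0 ^ 2 + a + a * b * γ 0 0 * γ 1 0;
        -b * γ 1 0 ^ 2, 1 + b * γ 0 0 * γ 1 0] := by
  have hdet := γ.det_coe
  rw [Matrix.det_fin_two] at hdet
  rw [Matrix.SpecialLinearGroup.coe_inv, Matrix.adjugate_fin_two]
  simp only [unipotent]
  ext i j
  fin_cases i <;> fin_cases j <;> simp [Matrix.mul_apply, Fin.sum_univ_two]
  · linear_combination hdet
  · linear_combination a * hdet
  · ring
  · linear_combination hdet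

/-- The matrix of `σ^(2c) γ σ² γ⁻¹`, where the first column `(x, z)` of `γ` is unimodular because
`x = -c N + (1 + N u) α` is congruent to `α` modulo `z`, and `α² = -d` is prime to `N = ξ z`. -/
lemma exists_normalClosure_matrix {R : Type*} [CommRing R] {ξ z α : R} {d N : ℕ}
    (hξz : ξ * z = N) (hα : α ^ 2 = -(d : R)) (hdN : d.Coprime N) (c u : ℤ) :
    ∃ E : SL(2, R), P R E ∈ Subgroup.normalClosure {P R (unipotent ξ)} ∧
      ∀ x : R, x = -(c * N) + (1 + N * u) * α → (E : Matrix (Fin 2) (Fin 2) R) =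
        !![1 - 2 * N * x - 4 * c * N ^ 2, 2 * ξ * (x ^ 2 + c + 2 * c * N * x);
          -2 * N * z, 1 + 2 * N * x] := by
  obtain ⟨x, hx⟩ : ∃ x : R, x = -(c * N) + (1 + N * u) * α := ⟨_, rfl⟩
  obtain ⟨e, f, hef⟩ : IsCoprime (d : ℤ) (N : ℤ) := Nat.isCoprime_iff_coprime.2 hdN
  have hef' : (e : R) * d + f * N = 1 := by exact_mod_cast congrArg (Int.cast : ℤ → R) hef
  have hdet : x * (-e * α) - (e * α * ξ * (c - u * α) - f * ξ) * z = 1 := by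
    rw [hx]
    linear_combination (f - e * α * (c - u * α)) * hξz + hef' - e * hα
  obtain ⟨γ, hγ0, hγ1⟩ : ∃ γ : SL(2, R), γ 0 0 = x ∧ γ 1 0 = z :=
    ⟨⟨!![x, e * α * ξ * (c - u * α) - f * ξ; z, -e * α], by
      rw [Matrix.det_fin_two_of, hdet]⟩, rfl, rfl⟩
  have hmem := unipotent_mul_conj_mem (K := Subgroup.normalClosure {P R (unipotent ξ)})
    (Subgroup.subset_normalClosure (Set.mem_singleton _)) (2 * c) 2 γ
  refine ⟨_, hmem, ?_⟩
  rintro _ rfl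
  rw [← hx, Matrix.SpecialLinearGroup.coe_mul, Matrix.SpecialLinearGroup.coe_mul,
    Matrix.SpecialLinearGroup.coe_mul, coe_unipotent_mul_conj, hγ0, hγ1, ← hξz]
  push_cast
  congr! 3 <;> ring_nf

/-- For `z = ξ̄` the hypothesis is `|x|² = c + D N`, and this is the condition for the matrix of
`exists_normalClosure_matrix` to lie in `Stab(C_D)`. -/
lemma normalClosure_inf_bianchiStab_ne_bot {d D N : ℕ} (hd : d.Prime) (ξ : ringOfInt d)
    (hN : Complex.normSq (algebraMap (ringOfInt d) ℂ ξ) = N) (hdN : ¬ d ∣ N) (c u : ℤ)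
    (h : c ^ 2 * N ^ 2 + d * (1 + N * u) ^ 2 = c + D * N) :
    Subgroup.normalClosure {P (ringOfInt d) (unipotent ξ)} ⊓
      bianchiStab d (circleOf D) ≠ ⊥ := by
  have hξz : ξ * conjInt d ξ = N := by
    apply algebraMap_injective d
    rw [map_mul, coe_conjInt, Complex.mul_conj, hN]; simp
  have hNpos : N ≠ 0 := by rintro rfl; simp at hdN
  have hN0 : (N : ringOfInt d) ≠ 0 := by exact_mod_cast hNpos
  obtain ⟨E, hmem, hE⟩ := exists_normalClosure_matrix hξz (sqrtNeg_sq d)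
    ((Nat.Prime.coprime_iff_not_dvd hd).2 hdN) c u
  specialize hE _ rfl
  have hα := sqrtNeg_sq d
  have hαc : conj (algebraMap (ringOfInt d) ℂ (sqrtNeg d)) =
      -algebraMap (ringOfInt d) ℂ (sqrtNeg d) := by
    simp [coe_sqrtNeg]
  have t2 : algebraMap (ringOfInt d) ℂ 2 = 2 := map_ofNat _ 2
  have t4 : algebraMap (ringOfInt d) ℂ 4 = 4 := map_ofNat _ 4
  have c2 : conj (2 : ℂ) = 2 := map_ofNat _ 2
  have c4 : conj (4 : ℂ) = 4 := map_ofNat _ 4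
  have hzc := coe_conjInt d ξ
  have hz0 : conjInt d ξ ≠ 0 := by
    intro h0
    rw [h0, mul_zero] at hξz
    exact hN0 hξz.symm
  generalize sqrtNeg d = α at *
  generalize conjInt d ξ = z at *
  have hc : (c ^ 2 * N ^ 2 + d * (1 + N * u) ^ 2 : ℂ) = c + D * N := by exact_mod_cast h
  have hα' := congrArg (algebraMap (ringOfInt d) ℂ) hα
  have hstab : P _ E ∈ bianchiStab d (circleOf D) := by
    apply mem_bianchiStab
    · apply algebraMap_injective d
      rw [coe_conjInt, hE]
      simp [hαc, t2, t4, c2, c4]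
      ring
    · apply algebraMap_injective d
      rw [map_mul, coe_conjInt, hE]
      simp [hzc, t2, c2] at hα' ⊢
      linear_combination (2 * algebraMap (ringOfInt d) ℂ ξ) * ((1 + N * u) ^ 2 * hα' - hc)
  intro hbot
  have h1 : P _ E = 1 := by
    rw [← Subgroup.mem_bot, ← hbot]
    exact ⟨hmem, hstab⟩
  have h2 : E ∈ Subgroup.center SL(2, ringOfInt d) := (QuotientGroup.eq_one_iff _).1 h1
  rw [Matrix.SpecialLinearGroup.mem_center_iff] at h2
  obtain ⟨r, -, hr⟩ := h2
  have h3 := congrFun (congrFun hr 1) 0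
  rw [hE] at h3
  simp [hz0, hNpos] at h3

end Bianchi

end

theorem theorem5p2p1 (d : ℕ) (hd : d.Prime) (hd3 : 3 ≤ d) (ξ : Bianchi.ringOfInt d)
    (hξ : ¬ ∃ m : ℤ, Complex.normSq (algebraMap (Bianchi.ringOfInt d) ℂ ξ) = d * m) :
    ∃ D : ℕ → ℕ, Function.Injective D ∧
      (∀ k, 0 < D k ∧ ¬ IsSquare (D k : ZMod d)) ∧
      (∀ k, Bianchi.IsCocompactFuchsian
        ((Bianchi.bianchiStab d (Bianchi.circleOf (D k))).map (Bianchi.incl d))) ∧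
      (∀ k, Subgroup.normalClosure {Bianchi.P (Bianchi.ringOfInt d) (Bianchi.unipotent ξ)} ⊓
        Bianchi.bianchiStab d (Bianchi.circleOf (D k)) ≠ ⊥) ∧
      Pairwise fun j k => ¬ Bianchi.CommensurableIn
        (Bianchi.bianchiStab d (Bianchi.circleOf (D j)))
        (Bianchi.bianchiStab d (Bianchi.circleOf (D k))) := by
  obtain ⟨N, hN⟩ := Bianchi.exists_normSq_eq d ξ
  have hdN : ¬ d ∣ N := by
    rintro ⟨m, rfl⟩
    exact hξ ⟨m, by rw [hN]; push_cast; ring⟩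
  obtain ⟨D, hinj, hD⟩ := Bianchi.exists_radii hd hd3 hdN (Bianchi.isSquare_normSq hd hd3 ξ hN)
  refine ⟨D, hinj, fun k => ⟨(hD k).1, (hD k).2.1⟩, fun k => ?_, fun k => ?_, fun j k hjk => ?_⟩
  · exact Bianchi.isCocompactFuchsian_bianchiStab hd (hD k).1 (hD k).2.1
  · obtain ⟨-, -, c, u, h⟩ := hD k
    exact Bianchi.normalClosure_inf_bianchiStab_ne_bot hd ξ hN hdN c u h
  · exact Bianchi.not_commensurableIn hd (hD k).2.1 (hD j).1 (hinj.ne hjk)
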